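/- Let $d\ge 1$, let $\Omega\subset\mathbb R^d$ be a bounded open set (for instance a bounded Lipschitz domain), let $T>0$ and $I=(0,T)$. For a Hilbert space $H$, $H^1(I;H)$ denotes the space of all $u\in L^2(I;H)$ with weak time derivative $\dot u\in L^2(I;H)$; each such $u$ is identified with its continuous representative on $\bar I=[0,T]$. The Laplacian $\Delta:H_0^1(\Omega)\to H^{-1}(\Omega)$ is given by $\langle\Delta z,w\rangle=-\int_\Omega\nabla z\cdot\nabla w\,dx$, functions $f\in L^2(\Omega)$ are regarded as elements of $H^{-1}(\Omega)$ via $\langle f,w\rangle=\int_\Omega f\,w\,dx$, and $\partial D(v)\subset H^{-1}(\Omega)$ denotes the convex subdifferential at $v\in H_0^1(\Omega)$ of $D:H_0^1(\Omega)\to\mathbb R$, $D(w)=\int_\Omega|w|\,dx$. Call $g\in H^1(I;L^2(\Omega))$ compatible if $\|g(0)\|_{L^\infty(\Omega)}\le 1$. For compatible $g$ let $\mathcal S(g)$ denote the unique $z\in H^1(I;H_0^1(\Omega))$ with $z(0)=0$ and $$0\in\partial D(\dot z(t))-\Delta z(t)-g(t)\quad\text{in }H^{-1}(\Omega)\text{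 for a.e. }t\in I .$$ Let $(g_n)_{n\in\mathbb N}$ be a sequence of compatible elements of $H^1(I;L^2(\Omega))$ such that $g_n\rightharpoonup g$ weakly in $H^1(I;L^2(\Omega))$. Then $g$ is compatible, the states $\mathcal S(g_n)$ ($n\in\mathbb N$) and $\mathcal S(g)$ are well defined (that is, they exist and are unique), and $$\mathcal S(g_n)\rightharpoonup\mathcal S(g)\quad\text{weakly in }H^1(I;H_0^1(\Omega)),\qquad \mathcal S(g_n)\to\mathcal S(g)\quad\text{strongly in }C(\bar I;H_0^1(\Omega)).$$ -/

import Mathlib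

open MeasureTheory Set Filter Topology TopologicalSpace
open scoped ENNReal Distributions

noncomputable section

namespace RateIndependent

/-! ### Function spaces on the spatial domain -/

/-- `ℝ^d` with the Euclidean norm. -/
abbrev Space (d : ℕ) := EuclideanSpace ℝ (Fin d)

/-- Lebesgue measure on `Ω`. -/
abbrev domMeasure {d : ℕ} (Ω : Opens (Space d)) : Measure (Space d) :=
  volume.restrict (Ω : Set (Space d))

/-- `L²(Ω)`. -/
abbrev L2 {d : ℕ} (Ω : Opens (Space d)) := Lp ℝ 2 (domMeasure Ω)

/-- `L²(Ω; ℝ^d)`. -/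
abbrev L2Vec {d : ℕ} (Ω : Opens (Space d)) := Lp (Space d) 2 (domMeasure Ω)

/-- `H₀¹(Ω)`, the closure of the test functions `C_c^∞(Ω)` with respect to the norm
`(‖w‖²_{L²} + ‖∇w‖²_{L²})^{1/2}`. An element is recorded as the pair `(w, ∇w)`.
On a bounded `Ω` in dimension `d ≥ 1` this norm is equivalent to `‖∇w‖_{L²}`
(Poincaré inequality), so that both norms give the same space and the same topologies. -/
def H01Submodule {d : ℕ} (Ω : Opens (Space d)) : Submodule ℝ (WithLp 2 (L2 Ω × L2Vec Ω)) :=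
  (Submodule.span ℝ {p : WithLp 2 (L2 Ω × L2Vec Ω) | ∃ φ : 𝓓(Ω, ℝ),
    (p.fst : Space d → ℝ) =ᵐ[domMeasure Ω] (fun x => φ x) ∧
    (p.snd : Space d → Space d) =ᵐ[domMeasure Ω]
      (fun x => gradient (fun y => φ y) x)}).topologicalClosure

/-- `H₀¹(Ω)` as a type. -/
abbrev H01 {d : ℕ} (Ω : Opens (Space d)) := ↥(H01Submodule Ω)

/-- The inclusion `H₀¹(Ω) → L²(Ω)`. -/
def H01.val {d : ℕ} {Ω : Opens (Space d)} : H01 Ω →L[ℝ] L2 Ω :=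
  (WithLp.fstL 2 ℝ (L2 Ω) (L2Vec Ω)).comp (H01Submodule Ω).subtypeL

/-- The weak gradient `∇ : H₀¹(Ω) → L²(Ω; ℝ^d)`. -/
def H01.grad {d : ℕ} {Ω : Opens (Space d)} : H01 Ω →L[ℝ] L2Vec Ω :=
  (WithLp.sndL 2 ℝ (L2 Ω) (L2Vec Ω)).comp (H01Submodule Ω).subtypeL

/-- `H⁻¹(Ω)`, the dual space of `H₀¹(Ω)`. -/
abbrev Hneg1 {d : ℕ} (Ω : Opens (Space d)) := StrongDual ℝ (H01 Ω)

/-- The distributional Laplacian, `⟨Δz, w⟩ = - ∫ ∇z · ∇w dx`. -/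
def laplacian {d : ℕ} {Ω : Opens (Space d)} (z : H01 Ω) : Hneg1 Ω :=
  -((innerSL ℝ (H01.grad z)).comp H01.grad)

/-- The embedding `L²(Ω) → H⁻¹(Ω)`, `⟨f, w⟩ = ∫ f w dx`. -/
def L2.toHneg1 {d : ℕ} {Ω : Opens (Space d)} (f : L2 Ω) : Hneg1 Ω :=
  (innerSL ℝ f).comp H01.val

/-- The dissipation `D(w) = ∫ |w| dx`. -/
def dissipation {d : ℕ} {Ω : Opens (Space d)} (w : H01 Ω) : ℝ :=
  ∫ x in (Ω : Set (Space d)), |(H01.val w : Space d → ℝ) x|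

/-- The convex subdifferential of `D` at `v`, a subset of `H⁻¹(Ω)`. -/
def subdiffDissipation {d : ℕ} {Ω : Opens (Space d)} (v : H01 Ω) : Set (Hneg1 Ω) :=
  {ξ | ∀ w : H01 Ω, dissipation v + ξ (w - v) ≤ dissipation w}

/-! ### Bochner-Sobolev spaces on the time interval `I = (0, T)` -/

/-- `L²(I; H)`. -/
abbrev BochnerL2 (T : ℝ) (H : Type*) [NormedAddCommGroup H] :=
  Lp H 2 (volume.restrict (Ioo (0 : ℝ) T))

/-- Elements of `L²(I; H)` are integrable on `(0, t)` for `t ∈ [0, T]`. -/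
theorem BochnerL2.intervalIntegrable {T : ℝ} {H : Type*} [NormedAddCommGroup H]
    (v : BochnerL2 T H) {t : ℝ} (ht : t ∈ Icc (0 : ℝ) T) :
    IntervalIntegrable v volume 0 t := by
  rw [intervalIntegrable_iff_integrableOn_Ioo_of_le ht.1]
  exact IntegrableOn.mono_set ((Lp.memLp v).integrable (by norm_num))
    (Ioo_subset_Ioo_right ht.2)

section Bochner

variable (T : ℝ) (H : Type*) [NormedAddCommGroup H] [NormedSpace ℝ H]

variable {T H} in
/-- If `v = v'` in `L²(I; H)` then the primitives agree on `[0, T]`. -/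
theorem intervalIntegral_congr_of_ae {v w : ℝ → H}
    (h : v =ᵐ[volume.restrict (Ioo (0 : ℝ) T)] w) {t : ℝ} (ht : t ∈ Icc (0 : ℝ) T) :
    ∫ s in (0 : ℝ)..t, v s = ∫ s in (0 : ℝ)..t, w s := by
  rw [intervalIntegral.integral_of_le ht.1, intervalIntegral.integral_of_le ht.1,
    integral_Ioc_eq_integral_Ioo, integral_Ioc_eq_integral_Ioo]
  exact integral_congr_ae (ae_restrict_of_ae_restrict_of_subset (Ioo_subset_Ioo_right ht.2) h)

/-- `H¹(I; H)`: the functions `u ∈ L²(I; H)` for which there are `v ∈ L²(I; H)` and `a ∈ H`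
with `u(t) = a + ∫₀ᵗ v(s) ds` for a.e. `t ∈ I`. Then `v` is the time derivative of `u`.
An element is recorded as the pair `(u, v)`, so that the norm is
`(‖u‖²_{L²(I; H)} + ‖u̇‖²_{L²(I; H)})^{1/2}`. -/
def BochnerH1Submodule : Submodule ℝ (WithLp 2 (BochnerL2 T H × BochnerL2 T H)) where
  carrier := {p | ∃ a : H, ∀ᵐ t ∂(volume.restrict (Ioo (0 : ℝ) T)),
    p.fst t = a + ∫ s in (0 : ℝ)..t, p.snd s}
  zero_mem' := by
    refine ⟨0, ?_⟩
    filter_upwards [ae_restrict_mem measurableSet_Ioo,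
      Lp.coeFn_zero H 2 (volume.restrict (Ioo (0 : ℝ) T))] with t ht h0
    rw [WithLp.zero_fst, WithLp.zero_snd, h0, intervalIntegral_congr_of_ae
      (Lp.coeFn_zero H 2 (volume.restrict (Ioo (0 : ℝ) T))) ⟨ht.1.le, ht.2.le⟩]
    simp
  add_mem' := by
    rintro p q ⟨a, ha⟩ ⟨b, hb⟩
    refine ⟨a + b, ?_⟩
    filter_upwards [ae_restrict_mem measurableSet_Ioo, Lp.coeFn_add p.fst q.fst, ha, hb]
      with t ht h1 hat hbt
    have ht' : t ∈ Icc (0 : ℝ) T := ⟨ht.1.le, ht.2.le⟩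
    rw [WithLp.add_fst, WithLp.add_snd, h1,
      intervalIntegral_congr_of_ae (Lp.coeFn_add p.snd q.snd) ht']
    simp only [Pi.add_apply]
    rw [intervalIntegral.integral_add (BochnerL2.intervalIntegrable p.snd ht')
      (BochnerL2.intervalIntegrable q.snd ht'), hat, hbt]
    abel
  smul_mem' := by
    rintro c p ⟨a, ha⟩
    refine ⟨c • a, ?_⟩
    filter_upwards [ae_restrict_mem measurableSet_Ioo, Lp.coeFn_smul c p.fst, ha]
      with t ht h1 hat
    rw [WithLp.smul_fst, WithLp.smul_snd, h1, intervalIntegral_congr_of_ae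
      (Lp.coeFn_smul c p.snd) ⟨ht.1.le, ht.2.le⟩]
    simp only [Pi.smul_apply]
    rw [intervalIntegral.integral_smul, hat, smul_add]

/-- `H¹(I; H)` as a type. -/
abbrev BochnerH1 := ↥(BochnerH1Submodule T H)

instance : NormedAddCommGroup (BochnerH1 T H) := inferInstance

instance : NormedSpace ℝ (BochnerH1 T H) := inferInstance

variable {T H}

/-- `u ∈ H¹(I; H)` as an element of `L²(I; H)`. -/
def BochnerH1.fn (u : BochnerH1 T H) : BochnerL2 T H :=
  (u : WithLp 2 (BochnerL2 T H × BochnerL2 T H)).fst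

/-- The time derivative `u̇ ∈ L²(I; H)` of `u ∈ H¹(I; H)`. -/
def BochnerH1.deriv (u : BochnerH1 T H) : BochnerL2 T H :=
  (u : WithLp 2 (BochnerL2 T H × BochnerL2 T H)).snd

/-- The initial value `u(0)` of `u ∈ H¹(I; H)`: the element `a` with
`u(t) = a + ∫₀ᵗ u̇(s) ds` for a.e. `t ∈ I`, which is unique when `T > 0`. -/
def BochnerH1.initialValue (u : BochnerH1 T H) : H := u.2.choose

/-- The continuous representative of `u ∈ H¹(I; H)` in `C([0, T]; H)`. -/
def BochnerH1.toContinuousMap (u : BochnerH1 T H) : C(Icc (0 : ℝ) T, H) where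
  toFun t := u.initialValue + ∫ s in (0 : ℝ)..(t : ℝ), u.deriv s
  continuous_toFun := by
    refine continuous_const.add ?_
    by_cases hT : 0 ≤ T
    · have h := intervalIntegral.continuousOn_primitive_interval'
        (BochnerL2.intervalIntegrable u.deriv (right_mem_Icc.2 hT)) left_mem_uIcc
      rw [uIcc_of_le hT] at h
      exact continuousOn_iff_continuous_domRestrict.1 h
    · have : IsEmpty (Icc (0 : ℝ) T) := by
        rw [Icc_eq_empty hT]; infer_instance
      exact continuous_of_const fun x => (this.false x).elim

end Bochner

/-- Weak convergence of a sequence in a normed space. -/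
def WeaklyConverges {X : Type*} [NormedAddCommGroup X] [NormedSpace ℝ X]
    (u : ℕ → X) (u₀ : X) : Prop :=
  ∀ ℓ : StrongDual ℝ X, Tendsto (fun n => ℓ (u n)) atTop (𝓝 (ℓ u₀))

/-! ### The rate-independent evolution -/

/-- The compatibility condition `‖g(0)‖_{L^∞(Ω)} ≤ 1`. -/
def Compatible {d : ℕ} {Ω : Opens (Space d)} {T : ℝ} (g : BochnerH1 T (L2 Ω)) : Prop :=
  eLpNorm (g.initialValue : Space d → ℝ) ∞ (domMeasure Ω) ≤ 1

/-- `z` is a state for the load `g`: `z ∈ H¹(I; H₀¹(Ω))`, `z(0) = 0`, and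
`0 ∈ ∂D(ż) - Δz - g` in `H⁻¹(Ω)`, a.e. in `I`. -/
def IsState {d : ℕ} {Ω : Opens (Space d)} {T : ℝ} (g : BochnerH1 T (L2 Ω))
    (z : BochnerH1 T (H01 Ω)) : Prop :=
  z.initialValue = 0 ∧
    ∀ᵐ t ∂(volume.restrict (Ioo (0 : ℝ) T)),
      ∃ ξ ∈ subdiffDissipation (z.deriv t), 0 = ξ - laplacian (z.fn t) - L2.toHneg1 (g.fn t)

open Classical in
/-- The control-to-state map `g ↦ S(g)`; the value is meaningful when a state exists. -/
def controlToState {d : ℕ} {Ω : Opens (Space d)} {T : ℝ} (g : BochnerH1 T (L2 Ω)) :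
    BochnerH1 T (H01 Ω) :=
  if h : ∃ z : BochnerH1 T (H01 Ω), IsState g z then h.choose else 0

end RateIndependent

end

/-!
The Dirichlet form `a(z, w) = ∫ ∇z · ∇w` turns `H₀¹(Ω)` into a Hilbert space `G`, by the Poincaré
inequality; in `G` the evolution reads `ℓ - z ∈ ∂D(ż)`, `z(0) = 0`, with `ℓ = (-Δ)⁻¹ g ∈ H¹(I; G)`.

Stability. If `zᵢ` solves the evolution for `ℓᵢ`, then monotonicity of `∂D` and the chain rule
`½ |z|² = ∫ ⟨z, ż⟩` give
`½ |z₁(t) - z₂(t)|² ≤ ∫ |ℓ₁ - ℓ₂| |ż₁ - ż₂|` (`IsApproxSolution.sq_norm_sub_le`). No time derivative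
of the loads enters, so bounded velocities and convergence of the loads in `L²(I; G)` suffice for
uniform convergence of the solutions. The estimate holds up to an additive tolerance for approximate
solutions as well, and it contains uniqueness.

Existence. The implicit Euler scheme is solved by projections onto the convex set `∂D(0)`; its
interpolants are approximate solutions whose velocities are bounded by `ℓ̇` in `L²(I; G)`
(`exists_isApproxSolution`). By stability their primitives converge uniformly; the velocities
converge weakly, and weak lower semicontinuity of `v ↦ ∫ D(v)` identifies the limit as a solution
(`exists_isApproxSolution_zero`). The bound for the velocities survives.

Compactness. If `gₙ ⇀ g` in `H¹(I; L²(Ω))`, then `gₙ(t) ⇀ g(t)` in `L²(Ω)` for every `t`. Since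
`L²(Ω) → H⁻¹(Ω)` is compact (`tendsto_norm_toHneg1`, proved by mollification on test functions), the
loads `ℓₙ(t)` converge in norm for every `t`, and in `L²(I; G)` by dominated convergence. Stability
then gives convergence of the states in `C([0, T]; H₀¹(Ω))`. As the velocities are bounded and a
velocity is determined by its primitive, weak convergence in `H¹(I; H₀¹(Ω))` follows
(`BochnerH1.weaklyConverges_of_tendsto`).
-/

namespace RateIndependent

open scoped RealInnerProductSpace

/-! ### Primitives of square integrable functions -/

section Primitive

variable {T : ℝ} {H : Type*} [NormedAddCommGroup H]

theorem ae_mem_Ioo : ∀ᵐ t ∂(volume.restrict (Ioo (0 : ℝ) T)), t ∈ Ioo (0 : ℝ) T :=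
  ae_restrict_mem measurableSet_Ioo

theorem BochnerL2.intervalIntegrable_of_mem (v : BochnerL2 T H) {s t : ℝ}
    (hs : s ∈ Icc (0 : ℝ) T) (ht : t ∈ Icc (0 : ℝ) T) : IntervalIntegrable v volume s t :=
  (BochnerL2.intervalIntegrable v hs).symm.trans (BochnerL2.intervalIntegrable v ht)

theorem integrable_norm_sq {α : Type*} {m : MeasurableSpace α} {μ : Measure α} (v : Lp H 2 μ) :
    Integrable (fun t => ‖v t‖ ^ 2) μ :=
  (memLp_two_iff_integrable_sq_norm (Lp.aestronglyMeasurable v)).1 (Lp.memLp v)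

theorem sq_norm_eq_integral {α : Type*} {m : MeasurableSpace α} {μ : Measure α} (v : Lp H 2 μ) :
    ‖v‖ ^ 2 = ∫ t, ‖v t‖ ^ 2 ∂μ := by
  rw [Lp.norm_def, (Lp.memLp v).eLpNorm_eq_integral_rpow_norm (by norm_num) (by norm_num),
    ENNReal.toReal_ofReal (by positivity)]
  have : 0 ≤ ∫ t, ‖v t‖ ^ 2 ∂μ := integral_nonneg fun _ => by positivity
  simp only [ENNReal.toReal_ofNat, Real.rpow_ofNat]
  rw [← Real.rpow_natCast, ← Real.rpow_mul this]
  norm_num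

theorem intervalIntegrable_norm_sq (v : BochnerL2 T H) {s t : ℝ}
    (hs : s ∈ Icc (0 : ℝ) T) (ht : t ∈ Icc (0 : ℝ) T) :
    IntervalIntegrable (fun r => ‖v r‖ ^ 2) volume s t := by
  have key : ∀ r ∈ Icc (0 : ℝ) T, IntervalIntegrable (fun r => ‖v r‖ ^ 2) volume 0 r := by
    intro r hr
    rw [intervalIntegrable_iff_integrableOn_Ioo_of_le hr.1]
    exact IntegrableOn.mono_set (integrable_norm_sq v) (Ioo_subset_Ioo_right hr.2)
  exact (key s hs).symm.trans (key t ht)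

theorem integral_norm_sq_le (v : BochnerL2 T H) {s t : ℝ} (hs : s ∈ Icc (0 : ℝ) T)
    (ht : t ∈ Icc (0 : ℝ) T) (hst : s ≤ t) : ∫ r in s..t, ‖v r‖ ^ 2 ≤ ‖v‖ ^ 2 := by
  rw [sq_norm_eq_integral, intervalIntegral.integral_of_le hst, integral_Ioc_eq_integral_Ioo]
  exact setIntegral_mono_set (integrable_norm_sq v) (ae_of_all _ fun _ => by positivity)
    (Ioo_subset_Ioo hs.1 ht.2).eventuallyLE

/-- The Cauchy-Schwarz inequality for a weight and the norm of an `L²` function. -/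
theorem integral_mul_norm_le {α : Type*} {m : MeasurableSpace α} {μ : Measure α} {ρ : α → ℝ}
    (hρ : MemLp ρ 2 μ) (hρ0 : ∀ᵐ t ∂μ, 0 ≤ ρ t) (v : Lp H 2 μ) :
    ∫ t, ρ t * ‖v t‖ ∂μ ≤ √(∫ t, ρ t ^ 2 ∂μ) * ‖v‖ := by
  have h := integral_mul_le_Lp_mul_Lq_of_nonneg (p := 2) (q := 2)
    (by constructor <;> norm_num) hρ0 (ae_of_all _ fun t => norm_nonneg (v t))
    (by simpa using hρ) (by simpa using (Lp.memLp v).norm)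
  simp only [Real.rpow_ofNat, ← Real.sqrt_eq_rpow, ← sq_norm_eq_integral,
    Real.sqrt_sq (norm_nonneg v)] at h
  exact h

theorem integrable_mul_norm {α : Type*} {m : MeasurableSpace α} {μ : Measure α} {ρ : α → ℝ}
    (hρ : MemLp ρ 2 μ) (v : Lp H 2 μ) : Integrable (fun t => ρ t * ‖v t‖) μ :=
  hρ.integrable_mul (Lp.memLp v).norm

/-- On a finite measure space the `L¹` norm is controlled by the `L²` norm. -/
theorem integral_norm_le_of_isFiniteMeasure {α : Type*} {m : MeasurableSpace α} {μ : Measure α}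
    [IsFiniteMeasure μ] (v : Lp H 2 μ) : ∫ t, ‖v t‖ ∂μ ≤ √(μ.real univ) * ‖v‖ := by
  have h := integral_mul_norm_le (ρ := fun _ => 1) (memLp_const 1) (ae_of_all _ fun _ => by simp) v
  simpa using h

theorem integral_norm_le (v : BochnerL2 T H) :
    ∫ t in Ioo (0 : ℝ) T, ‖v t‖ ≤ √T * ‖v‖ := by
  rcases le_or_gt T 0 with hT | hT
  · simp only [Ioo_eq_empty (not_lt.2 hT), Measure.restrict_empty, integral_zero_measure]
    positivity
  simpa [hT.le] using integral_norm_le_of_isFiniteMeasure v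

variable [NormedSpace ℝ H]

/-- The primitive `t ↦ ∫₀ᵗ v(s) ds` of `v ∈ L²(I; H)`; it is meaningful for `t ∈ [0, T]`. -/
noncomputable def primitive (v : BochnerL2 T H) (t : ℝ) : H := ∫ s in (0 : ℝ)..t, v s

@[simp] theorem primitive_zero_right (v : BochnerL2 T H) : primitive v 0 = 0 := by
  simp [primitive]

theorem primitive_sub_primitive (v : BochnerL2 T H) {s t : ℝ}
    (hs : s ∈ Icc (0 : ℝ) T) (ht : t ∈ Icc (0 : ℝ) T) :
    primitive v t - primitive v s = ∫ r in s..t, v r :=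
  intervalIntegral.integral_interval_sub_left (BochnerL2.intervalIntegrable v ht)
    (BochnerL2.intervalIntegrable v hs)

theorem primitive_add (v w : BochnerL2 T H) {t : ℝ} (ht : t ∈ Icc (0 : ℝ) T) :
    primitive (v + w) t = primitive v t + primitive w t := by
  unfold primitive
  rw [intervalIntegral_congr_of_ae (Lp.coeFn_add v w) ht]
  exact intervalIntegral.integral_add (BochnerL2.intervalIntegrable v ht)
    (BochnerL2.intervalIntegrable w ht)

theorem primitive_smul (c : ℝ) (v : BochnerL2 T H) {t : ℝ} (ht : t ∈ Icc (0 : ℝ) T) :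
    primitive (c • v) t = c • primitive v t := by
  unfold primitive
  rw [intervalIntegral_congr_of_ae (Lp.coeFn_smul c v) ht]
  exact intervalIntegral.integral_smul c _

theorem primitive_sub (v w : BochnerL2 T H) {t : ℝ} (ht : t ∈ Icc (0 : ℝ) T) :
    primitive (v - w) t = primitive v t - primitive w t := by
  unfold primitive
  rw [intervalIntegral_congr_of_ae (Lp.coeFn_sub v w) ht]
  exact intervalIntegral.integral_sub (BochnerL2.intervalIntegrable v ht)
    (BochnerL2.intervalIntegrable w ht)

theorem primitive_compLp {H' : Type*} [NormedAddCommGroup H'] [NormedSpace ℝ H']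
    [CompleteSpace H] [CompleteSpace H'] (L : H →L[ℝ] H') (v : BochnerL2 T H) {t : ℝ}
    (ht : t ∈ Icc (0 : ℝ) T) : primitive (L.compLp v) t = L (primitive v t) := by
  unfold primitive
  rw [intervalIntegral_congr_of_ae (L.coeFn_compLp v) ht]
  exact L.intervalIntegral_comp_comm (BochnerL2.intervalIntegrable v ht)

/-- The Cauchy-Schwarz inequality on `(s, t)`. -/
theorem sq_norm_integral_le (v : BochnerL2 T H) {s t : ℝ} (hs : s ∈ Icc (0 : ℝ) T)
    (ht : t ∈ Icc (0 : ℝ) T) (hst : s ≤ t) :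
    ‖∫ r in s..t, v r‖ ^ 2 ≤ (t - s) * ∫ r in s..t, ‖v r‖ ^ 2 := by
  rcases hst.eq_or_lt with rfl | hlt
  · simp
  have hpos : 0 < t - s := sub_pos.2 hlt
  have h1 : ‖∫ r in s..t, v r‖ ≤ ∫ r in s..t, ‖v r‖ :=
    intervalIntegral.norm_integral_le_integral_norm hst
  -- With `c` the mean value of `‖v‖`, the inequality is `0 ≤ ∫ (‖v‖ - c)²`.
  set c := (∫ r in s..t, ‖v r‖) / (t - s) with hc
  have hi := BochnerL2.intervalIntegrable_of_mem v hs ht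
  have h2 : 0 ≤ ∫ r in s..t, (‖v r‖ - c) ^ 2 :=
    intervalIntegral.integral_nonneg hst fun _ _ => sq_nonneg _
  have h3 : ∫ r in s..t, (‖v r‖ - c) ^ 2
      = (∫ r in s..t, ‖v r‖ ^ 2) - 2 * c * (∫ r in s..t, ‖v r‖) + (t - s) * c ^ 2 := by
    have : (fun r => (‖v r‖ - c) ^ 2) = fun r => (‖v r‖ ^ 2 - 2 * c * ‖v r‖) + c ^ 2 := by
      ext r; ring
    rw [this, intervalIntegral.integral_add
      ((intervalIntegrable_norm_sq v hs ht).sub (hi.norm.const_mul _)) intervalIntegrable_const,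
      intervalIntegral.integral_sub (intervalIntegrable_norm_sq v hs ht) (hi.norm.const_mul _),
      intervalIntegral.integral_const_mul, intervalIntegral.integral_const, smul_eq_mul]
  have h4 : (∫ r in s..t, ‖v r‖) = c * (t - s) := by rw [hc]; field_simp
  rw [h4] at h1 h3
  have h5 : c ^ 2 * (t - s) ≤ ∫ r in s..t, ‖v r‖ ^ 2 := by nlinarith
  calc ‖∫ r in s..t, v r‖ ^ 2 ≤ (c * (t - s)) ^ 2 := by gcongr
    _ = (t - s) * (c ^ 2 * (t - s)) := by ring
    _ ≤ _ := by gcongr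

theorem norm_primitive_sub_le (v : BochnerL2 T H) {s t : ℝ} (hs : s ∈ Icc (0 : ℝ) T)
    (ht : t ∈ Icc (0 : ℝ) T) (hst : s ≤ t) :
    ‖primitive v t - primitive v s‖ ≤ √(t - s) * ‖v‖ := by
  rw [primitive_sub_primitive v hs ht]
  have h0 : 0 ≤ t - s := sub_nonneg.2 hst
  apply le_of_sq_le_sq _ (by positivity)
  rw [mul_pow, Real.sq_sqrt h0]
  exact (sq_norm_integral_le v hs ht hst).trans
    (mul_le_mul_of_nonneg_left (integral_norm_sq_le v hs ht hst) h0)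

theorem norm_primitive_le (v : BochnerL2 T H) {t : ℝ} (ht : t ∈ Icc (0 : ℝ) T) :
    ‖primitive v t‖ ≤ √T * ‖v‖ := by
  have := norm_primitive_sub_le v (left_mem_Icc.2 (ht.1.trans ht.2)) ht ht.1
  simp only [primitive_zero_right, sub_zero] at this
  exact this.trans (by gcongr; exact ht.2)

/-- Taking the primitive at a fixed time is a bounded linear map `L²(I; H) → H`. -/
theorem exists_primitive_clm (H : Type*) [NormedAddCommGroup H] [NormedSpace ℝ H] {t : ℝ}
    (ht : t ∈ Icc (0 : ℝ) T) :
    ∃ L : BochnerL2 T H →L[ℝ] H, ∀ v, L v = primitive v t :=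
  ⟨LinearMap.mkContinuous
    { toFun := fun v => primitive v t
      map_add' := fun v w => primitive_add v w ht
      map_smul' := fun c v => primitive_smul c v ht } (√T)
    fun v => norm_primitive_le v ht, fun _ => rfl⟩

theorem continuousOn_primitive (v : BochnerL2 T H) : ContinuousOn (primitive v) (Icc 0 T) := by
  rcases lt_or_ge T 0 with hT | hT
  · simp [Icc_eq_empty (not_le.2 hT)]
  have h := intervalIntegral.continuousOn_primitive_interval'
    (BochnerL2.intervalIntegrable v (right_mem_Icc.2 hT)) left_mem_uIcc
  rwa [uIcc_of_le hT] at h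

/-- A function with vanishing primitive is zero, by Lebesgue's differentiation theorem. -/
theorem eq_zero_of_primitive_eq_zero [CompleteSpace H] (v : BochnerL2 T H)
    (h : ∀ t ∈ Icc (0 : ℝ) T, primitive v t = 0) : v = 0 := by
  rcases le_or_gt T 0 with hT | hT
  · refine Lp.ext (ae_mem_Ioo.mono fun t ht => ?_)
    exact absurd (ht.1.trans ht.2) (not_lt.2 hT)
  have hv := BochnerL2.intervalIntegrable v (right_mem_Icc.2 hT.le)
  refine Lp.ext ?_
  filter_upwards [ae_restrict_of_ae hv.ae_hasDerivAt_integral, ae_mem_Ioo, Lp.coeFn_zero H 2 _]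
    with t ht htI h0
  rw [uIcc_of_le hT.le] at ht
  have h1 := ht ⟨htI.1.le, htI.2.le⟩ 0 (left_mem_Icc.2 hT.le)
  have h2 : (fun x => ∫ s in (0 : ℝ)..x, v s) =ᶠ[𝓝 t] fun _ => (0 : H) :=
    (Icc_mem_nhds htI.1 htI.2 |> fun hm => Filter.mem_of_superset hm fun s hs => h s hs)
  rw [h0]
  exact h1.unique ((hasDerivAt_const t (0 : H)).congr_of_eventuallyEq h2)

theorem memLp_primitive (v : BochnerL2 T H) :
    MemLp (primitive v) 2 (volume.restrict (Ioo (0 : ℝ) T)) :=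
  MemLp.of_bound (((continuousOn_primitive v).mono Ioo_subset_Icc_self).aestronglyMeasurable
    measurableSet_Ioo) (√T * ‖v‖)
    (ae_mem_Ioo.mono fun _ ht => norm_primitive_le v (Ioo_subset_Icc_self ht))

theorem memLp_const_add_primitive (a : H) (v : BochnerL2 T H) :
    MemLp (fun t => a + primitive v t) 2 (volume.restrict (Ioo (0 : ℝ) T)) :=
  (memLp_const a).add (memLp_primitive v)

end Primitive

section Energy

variable {G : Type*} [NormedAddCommGroup G] [InnerProductSpace ℝ G] [CompleteSpace G]

/-- The chain rule `½ |z(t)|² = ∫₀ᵗ ⟨z(s), ż(s)⟩ ds` for `z = ∫₀ v`. It is obtained from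
Fubini's theorem by splitting the square `(0, t)²` along its diagonal. -/
theorem sq_norm_primitive_eq {v : ℝ → G} {t : ℝ} (ht : 0 ≤ t)
    (hv : IntervalIntegrable v volume 0 t) :
    IntervalIntegrable (fun s => ⟪∫ r in (0 : ℝ)..s, v r, v s⟫) volume 0 t ∧
    ‖∫ s in (0 : ℝ)..t, v s‖ ^ 2 = 2 * ∫ s in (0 : ℝ)..t, ⟪∫ r in (0 : ℝ)..s, v r, v s⟫ := by
  have hv' : Integrable v (volume.restrict (Ioc 0 t)) :=
    (intervalIntegrable_iff_integrableOn_Ioc_of_le ht).1 hv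
  rw [intervalIntegrable_iff_integrableOn_Ioc_of_le ht, IntegrableOn,
    intervalIntegral.integral_of_le ht, intervalIntegral.integral_of_le ht]
  set μ := (volume : Measure ℝ).restrict (Ioc 0 t) with hμ
  have hf : Integrable (fun p : ℝ × ℝ => ⟪v p.2, v p.1⟫) (μ.prod μ) := by
    have := Integrable.op_fst_snd (op := fun x y : G => ⟪y, x⟫) (by fun_prop)
      ⟨1, fun x y => by rw [one_mul, mul_comm]; exact norm_inner_le_norm y x⟩ hv' hv'
    exact this
  have hlt : MeasurableSet {p : ℝ × ℝ | p.2 < p.1} := measurableSet_lt measurable_snd measurable_fst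
  have hgt : MeasurableSet {p : ℝ × ℝ | p.1 < p.2} := measurableSet_lt measurable_fst measurable_snd
  have hin : ∀ s ∈ Ioc 0 t, ∫ r, {p : ℝ × ℝ | p.2 < p.1}.indicator
      (fun p => ⟪v p.2, v p.1⟫) (s, r) ∂μ = ⟪∫ r in (0 : ℝ)..s, v r, v s⟫ := by
    intro s hs
    have h1 : (fun r => {p : ℝ × ℝ | p.2 < p.1}.indicator (fun p => ⟪v p.2, v p.1⟫) (s, r))
        = (Iio s).indicator fun r => ⟪v r, v s⟫ := by
      ext r; simp [indicator]
    rw [h1, integral_indicator measurableSet_Iio, hμ, Measure.restrict_restrict measurableSet_Iio]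
    have h2 : Iio s ∩ Ioc 0 t = Ioo 0 s := by
      ext r; simp only [mem_inter_iff, mem_Iio, mem_Ioc, mem_Ioo]
      exact ⟨fun h => ⟨h.2.1, h.1⟩, fun h => ⟨h.2, h.1, h.2.le.trans hs.2⟩⟩
    rw [h2, intervalIntegral.integral_of_le hs.1.le, integral_Ioc_eq_integral_Ioo,
      real_inner_comm, ← integral_inner]
    · simp_rw [real_inner_comm]
    · exact IntegrableOn.mono_set hv' (fun r hr => ⟨hr.1, hr.2.le.trans hs.2⟩)
  have hfl := hf.indicator hlt
  have hmem : ∀ᵐ s ∂μ, s ∈ Ioc 0 t := ae_restrict_mem measurableSet_Ioc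
  refine ⟨hfl.integral_prod_left.congr (hmem.mono fun s hs => hin s hs), ?_⟩
  have hL : ‖∫ s, v s ∂μ‖ ^ 2 = ∫ p : ℝ × ℝ, ⟪v p.2, v p.1⟫ ∂(μ.prod μ) := by
    rw [integral_prod _ hf, ← real_inner_self_eq_norm_sq, ← integral_inner hv']
    refine integral_congr_ae (ae_of_all _ fun s => ?_)
    simp only
    rw [real_inner_comm, ← integral_inner hv']
    simp_rw [real_inner_comm]
  have hdiag : ∀ᵐ p : ℝ × ℝ ∂(μ.prod μ), p.1 ≠ p.2 := by
    refine (Measure.ae_prod_iff_ae_ae (p := fun p : ℝ × ℝ => p.1 ≠ p.2)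
      (measurableSet_eq_fun measurable_fst measurable_snd).compl).2 (ae_of_all _ fun s => ?_)
    exact (ae_restrict_of_ae (Measure.ae_ne volume s)).mono fun r hr => hr.symm
  have hsum : ∫ p : ℝ × ℝ, ⟪v p.2, v p.1⟫ ∂(μ.prod μ)
      = (∫ p, {p : ℝ × ℝ | p.2 < p.1}.indicator (fun p => ⟪v p.2, v p.1⟫) p ∂(μ.prod μ))
      + ∫ p, {p : ℝ × ℝ | p.1 < p.2}.indicator (fun p => ⟪v p.2, v p.1⟫) p ∂(μ.prod μ) := by
    rw [← integral_add hfl (hf.indicator hgt)]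
    refine integral_congr_ae (hdiag.mono fun p hp => ?_)
    rcases lt_or_gt_of_ne hp with h | h
    · simp [indicator, h, h.le]
    · simp [indicator, h, h.le]
  have hswap : ∫ p, {p : ℝ × ℝ | p.1 < p.2}.indicator (fun p => ⟪v p.2, v p.1⟫) p ∂(μ.prod μ)
      = ∫ p, {p : ℝ × ℝ | p.2 < p.1}.indicator (fun p => ⟪v p.2, v p.1⟫) p ∂(μ.prod μ) := by
    rw [← integral_prod_swap]
    refine integral_congr_ae (ae_of_all _ fun p => ?_)
    simp [indicator, real_inner_comm]
  rw [hL, hsum, hswap, ← two_mul, integral_prod _ hfl]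
  congr 1
  exact integral_congr_ae (hmem.mono fun s hs => hin s hs)

end Energy

/-! ### Subgradients of a seminorm on a Hilbert space -/

section Subgradient

variable {G : Type*} [NormedAddCommGroup G] [InnerProductSpace ℝ G]

theorem seminorm_continuous_of_le_mul_norm {X : Type*} [NormedAddCommGroup X] [NormedSpace ℝ X]
    (p : Seminorm ℝ X) (C : ℝ) (h : ∀ x, p x ≤ C * ‖x‖) : Continuous p := by
  refine Seminorm.continuous_of_le (q := C.toNNReal • normSeminorm ℝ X)
    (continuous_norm.const_smul C.toNNReal) fun x => ?_
  exact (h x).trans (mul_le_mul_of_nonneg_right (Real.le_coe_toNNReal C) (norm_nonneg x))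

/-- `y ∈ ∂D(v)`, for a seminorm `D` on a Hilbert space identified with its dual. -/
def IsSubgradient (D : Seminorm ℝ G) (v y : G) : Prop := ∀ w, D v + ⟪y, w - v⟫ ≤ D w

theorem isSubgradient_iff {D : Seminorm ℝ G} {v y : G} :
    IsSubgradient D v y ↔ (∀ w, ⟪y, w⟫ ≤ D w) ∧ D v ≤ ⟪y, v⟫ := by
  constructor
  · intro h
    refine ⟨fun w => ?_, ?_⟩
    · have h1 := h (w + v)
      have h2 := map_add_le_add D w v
      rw [add_sub_cancel_right] at h1
      linarith
    · have h1 := h 0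
      rw [zero_sub, inner_neg_right, map_zero] at h1
      linarith
  · rintro ⟨h1, h2⟩ w
    rw [inner_sub_right]
    linarith [h1 w]

theorem IsSubgradient.monotone {D : Seminorm ℝ G} {v₁ v₂ y₁ y₂ : G}
    (h₁ : IsSubgradient D v₁ y₁) (h₂ : IsSubgradient D v₂ y₂) : 0 ≤ ⟪y₁ - y₂, v₁ - v₂⟫ := by
  have a := h₁ v₂
  have b := h₂ v₁
  rw [← neg_sub v₁ v₂, inner_neg_right] at a
  rw [inner_sub_left]
  linarith

theorem IsSubgradient.smul {D : Seminorm ℝ G} {v y : G} (h : IsSubgradient D v y) {c : ℝ}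
    (hc : 0 ≤ c) : IsSubgradient D (c • v) y := by
  rw [isSubgradient_iff] at h ⊢
  refine ⟨h.1, ?_⟩
  rw [map_smul_eq_mul, inner_smul_right, Real.norm_of_nonneg hc]
  exact mul_le_mul_of_nonneg_left h.2 hc

/-- The bipolar theorem for a continuous seminorm: its value at `u` is attained by a subgradient. -/
theorem exists_inner_eq_seminorm [CompleteSpace G] {D : Seminorm ℝ G} (hD : Continuous D) (u : G) :
    ∃ k, (∀ w, ⟪k, w⟫ ≤ D w) ∧ ⟪k, u⟫ = D u := by
  obtain ⟨f, hf1, hf2⟩ : ∃ f : G →ₗ[ℝ] ℝ, f u = D u ∧ ∀ w, f w ≤ D w := by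
    by_cases hu : u = 0
    · exact ⟨0, by simp [hu], fun w => apply_nonneg D w⟩
    obtain ⟨g, hg1, hg2⟩ := exists_extension_of_le_sublinear
      (LinearPMap.mkSpanSingleton u (D u) hu) D
      (fun c hc x => by rw [map_smul_eq_mul, Real.norm_of_nonneg hc.le]) (map_add_le_add D) (by
        rintro ⟨x, hx⟩
        obtain ⟨c, rfl⟩ := Submodule.mem_span_singleton.1 hx
        rw [LinearPMap.mkSpanSingleton'_apply, map_smul_eq_mul, smul_eq_mul]
        exact mul_le_mul_of_nonneg_right (le_abs_self c) (apply_nonneg D u))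
    refine ⟨g, ?_, hg2⟩
    have := hg1 ⟨u, Submodule.mem_span_singleton_self u⟩
    exact this.trans (LinearPMap.mkSpanSingleton_apply ℝ ℝ hu (D u))
  obtain ⟨C, hC, hb⟩ := Seminorm.bound_of_continuous_normedSpace D hD
  let F : StrongDual ℝ G := f.mkContinuous C fun x => by
    rw [Real.norm_eq_abs, abs_le]
    refine ⟨?_, (hf2 x).trans (hb x)⟩
    have := (hf2 (-x)).trans (hb (-x))
    rw [map_neg, norm_neg] at this
    linarith
  refine ⟨(InnerProductSpace.toDual ℝ G).symm F, fun w => ?_, ?_⟩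
  · rw [InnerProductSpace.toDual_symm_apply]; exact hf2 w
  · rw [InnerProductSpace.toDual_symm_apply]; exact hf1

/-- The resolvent of `∂D`: `x - p` is the projection of `x` onto the convex set `∂D(0)`. -/
theorem exists_resolvent [CompleteSpace G] {D : Seminorm ℝ G} (hD : Continuous D) (x : G) :
    ∃ p, IsSubgradient D p (x - p) := by
  set K : Set G := {y | ∀ w, ⟪y, w⟫ ≤ D w} with hK
  have hconv : Convex ℝ K := by
    intro y hy y' hy' a b ha hb hab w
    rw [inner_add_left, real_inner_smul_left, real_inner_smul_left]
    calc a * ⟪y, w⟫ + b * ⟪y', w⟫ ≤ a * D w + b * D w := by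
          gcongr
          · exact hy w
          · exact hy' w
      _ = D w := by rw [← add_mul, hab, one_mul]
  have hcl : IsClosed K := by
    rw [hK, ofPred_forall]
    exact isClosed_iInter fun w => isClosed_le (by fun_prop) continuous_const
  obtain ⟨y, hy, hmin⟩ := exists_norm_eq_iInf_of_complete_convex
    ⟨0, fun w => by simp⟩ hcl.isComplete hconv x
  rw [norm_eq_iInf_iff_real_inner_le_zero hconv hy] at hmin
  refine ⟨x - y, isSubgradient_iff.2 ?_⟩
  rw [sub_sub_cancel]
  refine ⟨hy, ?_⟩
  obtain ⟨k, hk, hk'⟩ := exists_inner_eq_seminorm hD (x - y)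
  have := hmin k hk
  rw [inner_sub_right, real_inner_comm, hk', real_inner_comm] at this
  linarith

/-- The implicit time discretization: `z (k + 1)` is obtained from `z k` by a resolvent step, and
its increments are dominated by those of the load. -/
theorem exists_incremental_solution [CompleteSpace G] {D : Seminorm ℝ G} (hD : Continuous D)
    (a : ℕ → G) (h0 : ∀ w, ⟪a 0, w⟫ ≤ D w) :
    ∃ z : ℕ → G, z 0 = 0 ∧ ∀ k, IsSubgradient D (z (k + 1) - z k) (a (k + 1) - z (k + 1)) ∧
      ‖z (k + 1) - z k‖ ≤ ‖a (k + 1) - a k‖ := by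
  choose P hP using exists_resolvent (D := D) hD
  let z : ℕ → G := fun n => Nat.rec 0 (fun k x => x + P (a (k + 1) - x)) n
  have hz : ∀ k, z (k + 1) = z k + P (a (k + 1) - z k) := fun k => rfl
  -- `a k - z k` stays in `∂D(0)`; testing it with the next increment gives the bound.
  have hs : ∀ k, IsSubgradient D (z (k + 1) - z k) (a (k + 1) - z (k + 1)) := by
    intro k
    rw [hz, add_sub_cancel_left, ← sub_sub]
    exact hP _
  have hy : ∀ k, ∀ w, ⟪a k - z k, w⟫ ≤ D w := by
    rintro (_ | k)
    · simpa [z] using h0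
    · exact (isSubgradient_iff.1 (hs k)).1
  refine ⟨z, rfl, fun k => ⟨hs k, ?_⟩⟩
  have h1 := (isSubgradient_iff.1 (hs k)).2
  have h2 := hy k (z (k + 1) - z k)
  have h3 : ⟪a (k + 1) - z (k + 1), z (k + 1) - z k⟫ - ⟪a k - z k, z (k + 1) - z k⟫
      = ⟪a (k + 1) - a k, z (k + 1) - z k⟫ - ‖z (k + 1) - z k‖ ^ 2 := by
    rw [← real_inner_self_eq_norm_sq, ← inner_sub_left, ← inner_sub_left]
    congr 1; abel
  have h4 := real_inner_le_norm (a (k + 1) - a k) (z (k + 1) - z k)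
  rcases (norm_nonneg (z (k + 1) - z k)).eq_or_lt with h | h
  · rw [← h]; positivity
  · refine le_of_mul_le_mul_right ?_ h
    nlinarith

end Subgradient

/-! ### Weak limits in Hilbert spaces -/

section WeakLimit

variable {X : Type*} [NormedAddCommGroup X] [InnerProductSpace ℝ X] [CompleteSpace X]

/-- Weak compactness of balls, along an ultrafilter. -/
theorem exists_weak_limit (𝒰 : Ultrafilter ℕ) {u : ℕ → X} {C : ℝ} (hu : ∀ n, ‖u n‖ ≤ C) :
    ∃ u₀ : X, ‖u₀‖ ≤ C ∧ ∀ f : StrongDual ℝ X, Tendsto (fun n => f (u n)) 𝒰 (𝓝 (f u₀)) := by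
  let F : ℕ → WeakDual ℝ X := fun n => StrongDual.toWeakDual (InnerProductSpace.toDual ℝ X (u n))
  obtain ⟨f, hfm, hf⟩ := (WeakDual.isCompact_closedBall (0 : StrongDual ℝ X) C).ultrafilter_le_nhds
    (𝒰.map F) (by
      rw [Ultrafilter.coe_map, le_principal_iff, mem_map]
      refine Filter.univ_mem' fun n => ?_
      simpa [F] using hu n)
  have hT : Tendsto F 𝒰 (𝓝 f) := hf
  refine ⟨(InnerProductSpace.toDual ℝ X).symm (WeakDual.toStrongDual f), by simpa using hfm, ?_⟩
  intro g
  obtain ⟨x, rfl⟩ := (InnerProductSpace.toDual ℝ X).surjective g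
  have h1 := ((WeakDual.eval_continuous x).tendsto f).comp hT
  have h2 : (InnerProductSpace.toDual ℝ X x) ((InnerProductSpace.toDual ℝ X).symm
      (WeakDual.toStrongDual f)) = f x := by
    rw [InnerProductSpace.toDual_apply_apply, real_inner_comm,
      InnerProductSpace.toDual_symm_apply]; rfl
  rw [h2]
  refine h1.congr fun n => ?_
  change InnerProductSpace.toDual ℝ X (u n) x = _
  rw [InnerProductSpace.toDual_apply_apply, InnerProductSpace.toDual_apply_apply, real_inner_comm]

/-- Continuous seminorms are weakly lower semicontinuous. -/
theorem seminorm_le_of_weak_limit {p : Seminorm ℝ X} (hp : Continuous p) {ι : Type*}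
    {F : Filter ι} [F.NeBot] {u : ι → X} {u₀ : X}
    (hu : ∀ f : StrongDual ℝ X, Tendsto (fun n => f (u n)) F (𝓝 (f u₀)))
    {b : ι → ℝ} {c : ℝ} (hb : Tendsto b F (𝓝 c)) (hle : ∀ᶠ n in F, p (u n) ≤ b n) :
    p u₀ ≤ c := by
  obtain ⟨k, hk, hk'⟩ := exists_inner_eq_seminorm hp u₀
  rw [← hk']
  exact le_of_tendsto_of_tendsto (hu (innerSL ℝ k)) hb (hle.mono fun n hn => (hk _).trans hn)

end WeakLimit

/-! ### The abstract evolution: stability -/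

section Evolution

variable {T : ℝ} {G : Type*} [NormedAddCommGroup G] [InnerProductSpace ℝ G]

/-- `v` is the velocity of a solution of `ℓ - z ∈ ∂D(ż)`, `z(0) = 0`, up to an error `ε` in the
force `ℓ - z`: for a.e. `t` some `y` within distance `ε` of `ℓ(t) - z(t)` satisfies
`y ∈ ∂D(v(t))`, where `z` is the primitive of `v`. -/
def IsApproxSolution (D : Seminorm ℝ G) (ℓ : ℝ → G) (ε : ℝ) (v : BochnerL2 T G) : Prop :=
  ∀ᵐ t ∂(volume.restrict (Ioo (0 : ℝ) T)),
    ∃ y, IsSubgradient D (v t) y ∧ ‖y - (ℓ t - primitive v t)‖ ≤ ε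

/-- For `ε = 0` an approximate solution is a solution. -/
theorem isApproxSolution_zero {D : Seminorm ℝ G} {ℓ : ℝ → G} {v : BochnerL2 T G} :
    IsApproxSolution D ℓ 0 v ↔ ∀ᵐ t ∂(volume.restrict (Ioo (0 : ℝ) T)),
      IsSubgradient D (v t) (ℓ t - primitive v t) := by
  refine eventually_congr (ae_of_all _ fun t => ⟨?_, fun h => ⟨_, h, by simp⟩⟩)
  rintro ⟨y, hy, h⟩
  rwa [sub_eq_zero.1 (norm_le_zero_iff.1 h)] at hy

variable [CompleteSpace G]

/-- The energy estimate: if `⟨z, ż⟩ ≤ ρ |ż|` then `½ |z(t)|² ≤ ‖ρ‖ ‖ż‖` with norms in `L²(I)`. -/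
theorem sq_norm_primitive_le {v : BochnerL2 T G} {ρ : ℝ → ℝ}
    (hρ : MemLp ρ 2 (volume.restrict (Ioo (0 : ℝ) T)))
    (hρ0 : ∀ᵐ t ∂(volume.restrict (Ioo (0 : ℝ) T)), 0 ≤ ρ t)
    (h : ∀ᵐ t ∂(volume.restrict (Ioo (0 : ℝ) T)), ⟪primitive v t, v t⟫ ≤ ρ t * ‖v t‖)
    {t : ℝ} (ht : t ∈ Icc (0 : ℝ) T) :
    ‖primitive v t‖ ^ 2 ≤ 2 * (√(∫ s in Ioo (0 : ℝ) T, ρ s ^ 2) * ‖v‖) := by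
  obtain ⟨hi, he⟩ := sq_norm_primitive_eq ht.1 (BochnerL2.intervalIntegrable v ht)
  have hi' := (intervalIntegrable_iff_integrableOn_Ioo_of_le ht.1).1 hi
  have hsub : Ioo 0 t ⊆ Ioo 0 T := Ioo_subset_Ioo_right ht.2
  unfold primitive
  rw [he, intervalIntegral.integral_of_le ht.1, integral_Ioc_eq_integral_Ioo]
  gcongr
  calc ∫ s in Ioo 0 t, ⟪∫ r in (0 : ℝ)..s, v r, v s⟫
      ≤ ∫ s in Ioo 0 t, ρ s * ‖v s‖ :=
        integral_mono_ae hi' (IntegrableOn.mono_set (integrable_mul_norm hρ v) hsub)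
          (ae_restrict_of_ae_restrict_of_subset hsub h)
    _ ≤ ∫ s in Ioo 0 T, ρ s * ‖v s‖ :=
        setIntegral_mono_set (integrable_mul_norm hρ v)
          (hρ0.mono fun s hs => mul_nonneg hs (norm_nonneg _)) hsub.eventuallyLE
    _ ≤ _ := integral_mul_norm_le hρ hρ0 v

/-- Stability: the distance of two solutions is controlled by the distance of the loads, measured
without time derivatives, times the distance of the velocities. -/
theorem IsApproxSolution.sq_norm_sub_le {D : Seminorm ℝ G} {ℓ₁ ℓ₂ : ℝ → G} {ε₁ ε₂ : ℝ}
    {v₁ v₂ : BochnerL2 T G} (h₁ : IsApproxSolution D ℓ₁ ε₁ v₁) (h₂ : IsApproxSolution D ℓ₂ ε₂ v₂)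
    {ρ : ℝ → ℝ} (hρ : MemLp ρ 2 (volume.restrict (Ioo (0 : ℝ) T)))
    (hle : ∀ t ∈ Ioo (0 : ℝ) T, ‖ℓ₁ t - ℓ₂ t‖ + ε₁ + ε₂ ≤ ρ t)
    {t : ℝ} (ht : t ∈ Icc (0 : ℝ) T) :
    ‖primitive v₁ t - primitive v₂ t‖ ^ 2 ≤
      2 * (√(∫ s in Ioo (0 : ℝ) T, ρ s ^ 2) * ‖v₁ - v₂‖) := by
  rw [← primitive_sub v₁ v₂ ht]
  refine sq_norm_primitive_le hρ ?_ ?_ ht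
  · filter_upwards [h₁, h₂, ae_mem_Ioo] with s ⟨y₁, _, hy₁⟩ ⟨y₂, _, hy₂⟩ hs
    have := hle s hs
    linarith [norm_nonneg (ℓ₁ s - ℓ₂ s), (norm_nonneg _).trans hy₁, (norm_nonneg _).trans hy₂]
  · filter_upwards [h₁, h₂, ae_mem_Ioo, Lp.coeFn_sub v₁ v₂] with s ⟨y₁, hy₁, hn₁⟩ ⟨y₂, hy₂, hn₂⟩
      hs hsub
    rw [primitive_sub v₁ v₂ (Ioo_subset_Icc_self hs), hsub, Pi.sub_apply]
    have hmon := hy₁.monotone hy₂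
    -- `r` collects the errors in the two forces; the rest is monotone.
    set r := (y₁ - (ℓ₁ s - primitive v₁ s)) - (y₂ - (ℓ₂ s - primitive v₂ s)) with hr
    have hdec : primitive v₁ s - primitive v₂ s = (r + (ℓ₁ s - ℓ₂ s)) - (y₁ - y₂) := by
      rw [hr]; abel
    have hrn : ‖r + (ℓ₁ s - ℓ₂ s)‖ ≤ ρ s := by
      calc ‖r + (ℓ₁ s - ℓ₂ s)‖ ≤ ‖r‖ + ‖ℓ₁ s - ℓ₂ s‖ := norm_add_le _ _
        _ ≤ (ε₁ + ε₂) + ‖ℓ₁ s - ℓ₂ s‖ := by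
            gcongr
            exact (norm_sub_le _ _).trans (add_le_add hn₁ hn₂)
        _ ≤ ρ s := by linarith [hle s hs]
    rw [hdec, inner_sub_left]
    calc _ ≤ ⟪r + (ℓ₁ s - ℓ₂ s), v₁ s - v₂ s⟫ := by linarith
      _ ≤ ‖r + (ℓ₁ s - ℓ₂ s)‖ * ‖v₁ s - v₂ s‖ := real_inner_le_norm _ _
      _ ≤ _ := by gcongr

theorem IsApproxSolution.unique {D : Seminorm ℝ G} {ℓ : ℝ → G}
    {v₁ v₂ : BochnerL2 T G} (h₁ : IsApproxSolution D ℓ 0 v₁) (h₂ : IsApproxSolution D ℓ 0 v₂) :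
    v₁ = v₂ := by
  rw [← sub_eq_zero]
  refine eq_zero_of_primitive_eq_zero _ fun t ht => ?_
  have := h₁.sq_norm_sub_le h₂ (ρ := fun _ => 0) (by simp) (by simp) ht
  rw [primitive_sub _ _ ht]
  simpa using this

/-! ### The abstract evolution: existence -/

/-- The piecewise affine interpolants of the incremental solutions are approximate solutions. The
tolerance bounds the oscillation of `ℓ` and of the interpolant over one time step, by the Hölder
continuity of primitives. -/
theorem exists_isApproxSolution {D : Seminorm ℝ G} (hD : Continuous D) (hT : 0 < T) {ℓ₀ : G}
    (h0 : ∀ w, ⟪ℓ₀, w⟫ ≤ D w) (ℓ' : BochnerL2 T G) {N : ℕ} (hN : 0 < N) :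
    ∃ v : BochnerL2 T G, ‖v‖ ≤ ‖ℓ'‖ ∧
      IsApproxSolution D (fun t => ℓ₀ + primitive ℓ' t) (2 * (√(T / N) * ‖ℓ'‖)) v := by
  have hN' : (0 : ℝ) < N := Nat.cast_pos.2 hN
  set τ : ℝ := T / N with hτ
  have hτ0 : 0 < τ := by positivity
  have hNτ : N * τ = T := by rw [hτ]; field_simp
  have hmem : ∀ k ≤ N, (k : ℝ) * τ ∈ Icc (0 : ℝ) T := fun k hk =>
    ⟨by positivity, by rw [← hNτ]; gcongr⟩
  have hstep : ∀ k : ℕ, (k : ℝ) * τ ≤ ((k + 1 : ℕ) : ℝ) * τ := fun k => by gcongr; simp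
  have hlen : ∀ k : ℕ, ((k + 1 : ℕ) : ℝ) * τ - k * τ = τ := fun k => by push_cast; ring
  obtain ⟨z, hz0, hz⟩ := exists_incremental_solution hD
    (fun k : ℕ => ℓ₀ + primitive ℓ' (k * τ)) (by simpa using h0)
  -- The velocity equals `slope k` on the `k`-th time step `(kτ, (k + 1)τ)`.
  let slope : ℕ → G := fun k => τ⁻¹ • (z (k + 1) - z k)
  have hfloor : ∀ k : ℕ, ∀ t ∈ Ioo ((k : ℝ) * τ) (((k + 1 : ℕ) : ℝ) * τ), ⌊t / τ⌋₊ = k := by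
    intro k t ht
    rw [Nat.floor_eq_iff (div_nonneg ((by positivity : (0 : ℝ) ≤ k * τ).trans ht.1.le) hτ0.le)]
    refine ⟨(le_div_iff₀ hτ0).2 ht.1.le, (div_lt_iff₀ hτ0).2 ?_⟩
    have := ht.2
    push_cast at this
    exact this
  have hfl : ∀ t ∈ Ioo (0 : ℝ) T, ⌊t / τ⌋₊ < N ∧
      t ∈ Icc ((⌊t / τ⌋₊ : ℝ) * τ) (((⌊t / τ⌋₊ + 1 : ℕ) : ℝ) * τ) := by
    intro t ht
    have h1 := Nat.floor_le (div_nonneg ht.1.le hτ0.le)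
    have h2 := Nat.lt_floor_add_one (t / τ)
    rw [le_div_iff₀ hτ0] at h1
    rw [div_lt_iff₀ hτ0] at h2
    refine ⟨?_, h1, by push_cast; exact h2.le⟩
    have : (⌊t / τ⌋₊ : ℝ) * τ < N * τ := by rw [hNτ]; exact h1.trans_lt ht.2
    exact_mod_cast lt_of_mul_lt_mul_right this hτ0.le
  have hmeas : StronglyMeasurable (fun t : ℝ => slope ⌊t / τ⌋₊) :=
    (StronglyMeasurable.of_discrete (f := slope)).comp_measurable
      (Nat.measurable_floor.comp (measurable_id.div_const τ))
  have hLp : MemLp (fun t : ℝ => slope ⌊t / τ⌋₊) 2 (volume.restrict (Ioo (0 : ℝ) T)) := by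
    refine MemLp.of_bound hmeas.aestronglyMeasurable (∑ k ∈ Finset.range N, ‖slope k‖) ?_
    filter_upwards [ae_mem_Ioo] with t ht
    exact Finset.single_le_sum (f := fun k => ‖slope k‖) (fun _ _ => norm_nonneg _)
      (Finset.mem_range.2 (hfl t ht).1)
  set v : BochnerL2 T G := hLp.toLp _ with hv
  have hvae : ∀ k < N, ∀ᵐ t ∂(volume.restrict (Ioo ((k : ℝ) * τ) (((k + 1 : ℕ) : ℝ) * τ))),
      v t = slope k := by
    intro k hk
    filter_upwards [ae_restrict_of_ae_restrict_of_subset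
      (Ioo_subset_Ioo (hmem k hk.le).1 (hmem (k + 1) hk).2) hLp.coeFn_toLp,
      ae_restrict_mem measurableSet_Ioo] with t h1 h2
    rw [hv, h1, hfloor k t h2]
  have hprim : ∀ k ≤ N, primitive v (k * τ) = z k := by
    intro k
    induction k with
    | zero => intro _; simp [hz0]
    | succ k ih =>
      intro hk
      have h1 := primitive_sub_primitive v (hmem k (Nat.le_of_succ_le hk)) (hmem (k + 1) hk)
      rw [ih (Nat.le_of_succ_le hk), intervalIntegral.integral_of_le (hstep k),
        integral_Ioc_eq_integral_Ioo, integral_congr_ae (hvae k hk), setIntegral_const,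
        Measure.real, Real.volume_Ioo, hlen, ENNReal.toReal_ofReal hτ0.le,
        smul_inv_smul₀ hτ0.ne'] at h1
      exact sub_left_injective h1
  -- On each step the increment of `z` is at most that of `ℓ`; Cauchy-Schwarz bounds the latter.
  have hnorm : ‖v‖ ≤ ‖ℓ'‖ := by
    refine le_of_sq_le_sq ?_ (norm_nonneg _)
    have hsplit : ∀ w : BochnerL2 T G, ‖w‖ ^ 2 = ∑ k ∈ Finset.range N,
        ∫ t in ((k : ℝ) * τ)..(((k + 1 : ℕ) : ℝ) * τ), ‖w t‖ ^ 2 := by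
      intro w
      rw [intervalIntegral.sum_integral_adjacent_intervals (a := fun k : ℕ => (k : ℝ) * τ)
        (fun k hk => intervalIntegrable_norm_sq w (hmem k hk.le) (hmem (k + 1) hk)), hNτ,
        Nat.cast_zero, zero_mul, intervalIntegral.integral_of_le hT.le,
        integral_Ioc_eq_integral_Ioo, sq_norm_eq_integral]
    rw [hsplit v, hsplit ℓ']
    refine Finset.sum_le_sum fun k hk => ?_
    rw [Finset.mem_range] at hk
    have h1 : ∫ t in ((k : ℝ) * τ)..(((k + 1 : ℕ) : ℝ) * τ), ‖v t‖ ^ 2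
        = τ⁻¹ * ‖z (k + 1) - z k‖ ^ 2 := by
      rw [intervalIntegral.integral_of_le (hstep k), integral_Ioc_eq_integral_Ioo,
        integral_congr_ae ((hvae k hk).mono fun t ht => by
          simp only [ht] : _ =ᵐ[_] fun _ => ‖slope k‖ ^ 2), setIntegral_const,
        Measure.real, Real.volume_Ioo, hlen, ENNReal.toReal_ofReal hτ0.le, smul_eq_mul,
        norm_smul, Real.norm_of_nonneg (inv_nonneg.2 hτ0.le)]
      field_simp
    have h2 := sq_norm_integral_le ℓ' (hmem k hk.le) (hmem (k + 1) hk) (hstep k)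
    rw [← primitive_sub_primitive ℓ' (hmem k hk.le) (hmem (k + 1) hk), hlen] at h2
    have h3 := (hz k).2
    rw [add_sub_add_left_eq_sub] at h3
    rw [h1, inv_mul_le_iff₀ hτ0]
    exact le_trans (by gcongr) h2
  refine ⟨v, hnorm, ?_⟩
  filter_upwards [hLp.coeFn_toLp, ae_mem_Ioo] with t hvt ht
  obtain ⟨hk, htI⟩ := hfl t ht
  set k := ⌊t / τ⌋₊ with hkdef
  have hmt := Ioo_subset_Icc_self ht
  -- The force at the right end point of the time step.
  refine ⟨ℓ₀ + primitive ℓ' (((k + 1 : ℕ) : ℝ) * τ) - z (k + 1), ?_, ?_⟩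
  · rw [← hv] at hvt
    rw [hvt]
    exact (hz k).1.smul (inv_nonneg.2 hτ0.le)
  have hd : ∀ w : BochnerL2 T G, ‖primitive w (((k + 1 : ℕ) : ℝ) * τ) - primitive w t‖
      ≤ √τ * ‖w‖ := by
    intro w
    refine (norm_primitive_sub_le w hmt (hmem (k + 1) hk) htI.2).trans ?_
    gcongr
    linarith [hlen k, htI.1]
  rw [← hprim (k + 1) hk]
  have : ∀ a b c e : G, ℓ₀ + a - b - (ℓ₀ + c - e) = (a - c) - (b - e) := fun a b c e => by abel
  rw [this]
  calc _ ≤ √τ * ‖ℓ'‖ + √τ * ‖v‖ := (norm_sub_le _ _).trans (add_le_add (hd ℓ') (hd v))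
    _ ≤ √τ * ‖ℓ'‖ + √τ * ‖ℓ'‖ := by gcongr
    _ = _ := by ring

end Evolution

section Existence

variable {T : ℝ} {G : Type*} [NormedAddCommGroup G] [InnerProductSpace ℝ G]

/-- The seminorm `v ↦ ∫₀ᵀ D(v(t)) dt` on `L²(I; G)`. -/
theorem exists_integral_seminorm {D : Seminorm ℝ G} (hD : Continuous D) (T : ℝ) :
    (∀ v : BochnerL2 T G, Integrable (fun t => D (v t)) (volume.restrict (Ioo (0 : ℝ) T))) ∧
    ∃ F : Seminorm ℝ (BochnerL2 T G), Continuous F ∧ ∀ v, F v = ∫ t in Ioo (0 : ℝ) T, D (v t) := by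
  obtain ⟨C, hC, hb⟩ := Seminorm.bound_of_continuous_normedSpace D hD
  have hint : ∀ v : BochnerL2 T G,
      Integrable (fun t => D (v t)) (volume.restrict (Ioo (0 : ℝ) T)) := by
    intro v
    have h1 : Integrable v (volume.restrict (Ioo (0 : ℝ) T)) :=
      (Lp.memLp v).integrable (by norm_num)
    refine (h1.norm.const_mul C).mono' (hD.comp_aestronglyMeasurable h1.1) (ae_of_all _ fun t => ?_)
    rw [Real.norm_of_nonneg (apply_nonneg D _)]
    exact hb _
  refine ⟨hint, Seminorm.of (fun v => ∫ t in Ioo (0 : ℝ) T, D (v t)) ?_ ?_, ?_, fun v => rfl⟩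
  · intro v w
    rw [← integral_add (hint v) (hint w)]
    refine integral_mono_ae (hint _) ((hint v).add (hint w)) ?_
    filter_upwards [Lp.coeFn_add v w] with t ht
    rw [ht]
    exact map_add_le_add D _ _
  · intro c v
    rw [← integral_const_mul]
    refine integral_congr_ae ?_
    filter_upwards [Lp.coeFn_smul c v] with t ht
    rw [ht]
    exact map_smul_eq_mul D _ _
  · refine seminorm_continuous_of_le_mul_norm _ (C * √T) fun v => ?_
    calc ∫ t in Ioo (0 : ℝ) T, D (v t) ≤ ∫ t in Ioo (0 : ℝ) T, C * ‖v t‖ :=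
          integral_mono (hint v)
            (((Lp.memLp v).integrable (by norm_num)).norm.const_mul C) fun t => hb _
      _ = C * ∫ t in Ioo (0 : ℝ) T, ‖v t‖ := integral_const_mul _ _
      _ ≤ C * (√T * ‖v‖) := by gcongr; exact integral_norm_le v
      _ = _ := by ring

variable [CompleteSpace G]

/-- Existence for the evolution `ℓ - z ∈ ∂D(ż)`, `z(0) = 0`, for a load in `H¹(I; G)` whose initial
value lies in `∂D(0)`. -/
theorem exists_isApproxSolution_zero {D : Seminorm ℝ G} (hD : Continuous D) (hT : 0 < T) {ℓ₀ : G}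
    (h0 : ∀ w, ⟪ℓ₀, w⟫ ≤ D w) (ℓ' : BochnerL2 T G) :
    ∃ v : BochnerL2 T G, ‖v‖ ≤ ‖ℓ'‖ ∧
      IsApproxSolution D (fun t => ℓ₀ + primitive ℓ' t) 0 v := by
  set ℓ : ℝ → G := fun t => ℓ₀ + primitive ℓ' t with hℓ
  set μ := volume.restrict (Ioo (0 : ℝ) T) with hμ
  let ε : ℕ → ℝ := fun n => 2 * (√(T / (n + 1 : ℕ)) * ‖ℓ'‖)
  choose u hun hu using fun n : ℕ => exists_isApproxSolution hD hT h0 ℓ' n.succ_pos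
  have hu' : ∀ n, IsApproxSolution D ℓ (ε n) (u n) := hu
  have hε : Tendsto ε atTop (𝓝 0) := by
    have h1 : Tendsto (fun n : ℕ => T / ((n + 1 : ℕ) : ℝ)) atTop (𝓝 0) :=
      (tendsto_const_div_atTop_nhds_zero_nat T).comp (tendsto_add_atTop_nat 1)
    have h2 := (h1.sqrt.mul_const ‖ℓ'‖).const_mul 2
    rw [Real.sqrt_zero, zero_mul, mul_zero] at h2
    exact h2
  have hε0 : ∀ n, 0 ≤ ε n := fun n => by positivity
  have hεmono : ∀ n m, n ≤ m → ε m ≤ ε n := by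
    intro n m h
    simp only [ε]
    gcongr
  -- A weak limit of the velocities exists along an ultrafilter; uniqueness is not needed here.
  let 𝒰 : Ultrafilter ℕ := hyperfilter ℕ
  have h𝒰 : (𝒰 : Filter ℕ) ≤ atTop := Nat.hyperfilter_le_atTop
  obtain ⟨v, hvn, hv⟩ := exists_weak_limit 𝒰 hun
  -- The primitives of the approximate velocities converge uniformly to the primitive of `v`.
  let δ : ℕ → ℝ := fun n => √(2 * (√(T * (ε n + ε n) ^ 2) * (‖ℓ'‖ + ‖ℓ'‖)))
  have hconv : ∀ n, ∀ t ∈ Icc (0 : ℝ) T, ‖primitive (u n) t - primitive v t‖ ≤ δ n := by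
    intro n t ht
    obtain ⟨L, hL⟩ := exists_primitive_clm G ht
    set a := primitive (u n) t - primitive v t with ha
    have h1 : ∀ m ≥ n, ‖primitive (u n) t - primitive (u m) t‖ ≤ δ n := by
      intro m hm
      refine Real.le_sqrt_of_sq_le ?_
      have := (hu' n).sq_norm_sub_le (hu' m) (ρ := fun _ => ε n + ε n) (memLp_const _)
        (fun s _ => by simpa using hεmono n m hm) ht
      refine this.trans ?_
      rw [setIntegral_const, Measure.real, Real.volume_Ioo, sub_zero,
        ENNReal.toReal_ofReal hT.le, smul_eq_mul]
      gcongr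
      exact (norm_sub_le _ _).trans (add_le_add (hun n) (hun m))
    have h2 : Tendsto (fun m => ⟪a, primitive (u n) t - primitive (u m) t⟫) 𝒰 (𝓝 ⟪a, a⟫) := by
      have h3 := hv ((innerSL ℝ a).comp L)
      simp only [ContinuousLinearMap.comp_apply, hL, innerSL_apply_apply] at h3
      have h4 := h3.const_sub ⟪a, primitive (u n) t⟫
      simp only [← inner_sub_right] at h4
      exact h4
    have h5 : ⟪a, a⟫ ≤ ‖a‖ * δ n := by
      refine le_of_tendsto h2 (((eventually_ge_atTop n).filter_mono h𝒰).mono fun m hm => ?_)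
      exact (real_inner_le_norm _ _).trans (by gcongr; exact h1 m hm)
    rw [real_inner_self_eq_norm_sq] at h5
    rcases (norm_nonneg a).eq_or_lt with h | h
    · exact h ▸ Real.sqrt_nonneg _
    · exact le_of_mul_le_mul_left (by nlinarith) h
  have hδ : Tendsto δ atTop (𝓝 0) := by
    have h1 : Tendsto (fun n => √(2 * (√(T * (ε n + ε n) ^ 2) * (‖ℓ'‖ + ‖ℓ'‖)))) atTop
        (𝓝 (√(2 * (√(T * (0 + 0) ^ 2) * (‖ℓ'‖ + ‖ℓ'‖))))) :=
      ((((((hε.add hε).pow 2).const_mul T).sqrt).mul_const _).const_mul 2).sqrt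
    rw [add_zero, zero_pow two_ne_zero, mul_zero, Real.sqrt_zero, zero_mul, mul_zero,
      Real.sqrt_zero] at h1
    exact h1
  refine ⟨v, hvn, isApproxSolution_zero.2 ?_⟩
  -- Limit of the constraint `ℓ - z ∈ ∂D(0)`.
  have hK : ∀ᵐ t ∂μ, ∀ w, ⟪ℓ t - primitive v t, w⟫ ≤ D w := by
    filter_upwards [ae_all_iff.2 hu', ae_mem_Ioo] with t ht htI w
    have h1 : ∀ n, ⟪ℓ t - primitive v t, w⟫ ≤ D w + (ε n + δ n) * ‖w‖ := by
      intro n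
      obtain ⟨y, hy, hn⟩ := ht n
      have h2 : ℓ t - primitive v t = y - (y - (ℓ t - primitive (u n) t))
          + (primitive (u n) t - primitive v t) := by abel
      have h3 := (isSubgradient_iff.1 hy).1 w
      have h4 := (abs_le.1 (abs_real_inner_le_norm (y - (ℓ t - primitive (u n) t)) w)).1
      have h5 := real_inner_le_norm (primitive (u n) t - primitive v t) w
      have h6 := mul_le_mul_of_nonneg_right hn (norm_nonneg w)
      have h7 := mul_le_mul_of_nonneg_right (hconv n t (Ioo_subset_Icc_self htI)) (norm_nonneg w)
      rw [h2, inner_add_left, inner_sub_left]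
      nlinarith
    have h8 : Tendsto (fun n => D w + (ε n + δ n) * ‖w‖) atTop (𝓝 (D w + (0 + 0) * ‖w‖)) :=
      ((hε.add hδ).mul_const _).const_add _
    have h9 := ge_of_tendsto' h8 h1
    simpa using h9
  -- Limit of the energy balance `∫ D(ż) = ∫ ⟨ℓ - z, ż⟩`.
  obtain ⟨hint, F, hF, hFv⟩ := exists_integral_seminorm hD T
  have hyLp : ∀ w : BochnerL2 T G, MemLp (fun t => ℓ t - primitive w t) 2 μ := fun w =>
    (memLp_const_add_primitive ℓ₀ ℓ').sub (memLp_primitive w)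
  let Y : BochnerL2 T G → BochnerL2 T G := fun w => (hyLp w).toLp _
  have hYi : ∀ w w' : BochnerL2 T G, Integrable (fun t => ⟪ℓ t - primitive w t, w' t⟫) μ := by
    intro w w'
    refine (L2.integrable_inner (𝕜 := ℝ) (Y w) w').congr ?_
    filter_upwards [(hyLp w).coeFn_toLp] with t ht
    simp only [Y, ht]
  have hY : ∀ w w' : BochnerL2 T G, ⟪Y w, w'⟫ = ∫ t, ⟪ℓ t - primitive w t, w' t⟫ ∂μ := by
    intro w w'
    rw [L2.inner_def]
    refine integral_congr_ae ?_
    filter_upwards [(hyLp w).coeFn_toLp] with t ht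
    simp only [Y, ht]
  have hFn : ∀ n, F (u n) ≤ ⟪Y v, u n⟫ + (ε n + δ n) * (√T * ‖ℓ'‖) := by
    intro n
    have hn1 : Integrable (fun t => ‖u n t‖) μ := ((Lp.memLp (u n)).integrable (by norm_num)).norm
    rw [hFv, hY]
    calc ∫ t, D (u n t) ∂μ
        ≤ ∫ t, (⟪ℓ t - primitive v t, u n t⟫ + (ε n + δ n) * ‖u n t‖) ∂μ := by
          refine integral_mono_ae (hint _) ((hYi v (u n)).add (hn1.const_mul _)) ?_
          filter_upwards [hu' n, ae_mem_Ioo] with t ⟨y, hy, hn⟩ htI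
          have h2 : ℓ t - primitive v t = y - (y - (ℓ t - primitive (u n) t))
              + (primitive (u n) t - primitive v t) := by abel
          have h3 := (isSubgradient_iff.1 hy).2
          have h4 := real_inner_le_norm (y - (ℓ t - primitive (u n) t)) (u n t)
          have h5 := (abs_le.1
            (abs_real_inner_le_norm (primitive (u n) t - primitive v t) (u n t))).1
          have h6 := mul_le_mul_of_nonneg_right hn (norm_nonneg (u n t))
          have h7 := mul_le_mul_of_nonneg_right (hconv n t (Ioo_subset_Icc_self htI))
            (norm_nonneg (u n t))
          rw [h2, inner_add_left, inner_sub_left]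
          nlinarith
      _ = (∫ t, ⟪ℓ t - primitive v t, u n t⟫ ∂μ) + (ε n + δ n) * ∫ t, ‖u n t‖ ∂μ := by
          rw [integral_add (hYi v (u n)) (hn1.const_mul _), integral_const_mul]
      _ ≤ _ := by
          gcongr
          exact (integral_norm_le (u n)).trans (by gcongr; exact hun n)
  have hFle : F v ≤ ⟪Y v, v⟫ + (0 + 0) * (√T * ‖ℓ'‖) :=
    seminorm_le_of_weak_limit hF hv ((hv (innerSL ℝ (Y v))).add
      (((hε.mono_left h𝒰).add (hδ.mono_left h𝒰)).mul_const _)) (Eventually.of_forall hFn)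
  rw [hFv, hY, add_zero, zero_mul, add_zero] at hFle
  -- Equality in the integrated balance forces equality almost everywhere.
  have hae : (fun t => D (v t) - ⟪ℓ t - primitive v t, v t⟫) =ᵐ[μ] 0 := by
    have hnn : 0 ≤ᵐ[μ] fun t => D (v t) - ⟪ℓ t - primitive v t, v t⟫ :=
      hK.mono fun t ht => sub_nonneg.2 (ht _)
    rw [← integral_eq_zero_iff_of_nonneg_ae hnn ((hint v).sub (hYi v v))]
    refine le_antisymm ?_ (integral_nonneg_of_ae hnn)
    rw [integral_sub (hint v) (hYi v v)]
    linarith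
  filter_upwards [hK, hae] with t h1 h2
  exact isSubgradient_iff.2 ⟨h1, (sub_eq_zero.1 h2).le⟩

end Existence

/-! ### Inequalities for compactly supported functions -/

section CompactSupport

variable {E : Type*} [NormedAddCommGroup E] [InnerProductSpace ℝ E] [FiniteDimensional ℝ E]
  [MeasurableSpace E] [BorelSpace E]

/-- The Poincaré inequality. With a unit vector `e`, it follows from
`∫ u² = - ∫ ⟨e, x⟩ ∂ₑ(u²) dx`. -/
theorem integral_sq_le_integral_sq_fderiv {e : E} (he : ‖e‖ = 1) {u : E → ℝ}
    (hu : ContDiff ℝ 1 u) (hc : HasCompactSupport u) {R : ℝ} (hR : ∀ x, u x ≠ 0 → ‖x‖ ≤ R) :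
    ∫ x, u x ^ 2 ≤ 4 * R ^ 2 * ∫ x, ‖fderiv ℝ u x‖ ^ 2 := by
  have hd : Continuous (fderiv ℝ u) := hu.continuous_fderiv one_ne_zero
  have hint : ∀ {f : E → ℝ}, Continuous f → HasCompactSupport f → Integrable f :=
    fun h1 h2 => h1.integrable_of_hasCompactSupport h2
  have hc2 : HasCompactSupport (fun x => u x ^ 2) :=
    hc.comp_left (g := fun y : ℝ => y ^ 2) (by simp)
  have hcd : HasCompactSupport (fderiv ℝ u) := hc.fderiv ℝ
  have hcd2 : HasCompactSupport (fun x => ‖fderiv ℝ u x‖ ^ 2) :=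
    hcd.comp_left (g := fun y => ‖y‖ ^ 2) (by simp)
  have hfd : ∀ x, fderiv ℝ (fun x => u x ^ 2) x e = 2 * u x * fderiv ℝ u x e := by
    intro x
    have := ((hu.differentiable one_ne_zero x).hasFDerivAt.pow 2).fderiv
    rw [this]; simp
  have hfe : ∀ x, fderiv ℝ (fun x : E => ⟪e, x⟫) x e = 1 := by
    intro x
    have h2 : fderiv ℝ (fun x : E => ⟪e, x⟫) x = innerSL ℝ e :=
      ((innerSL ℝ e).hasFDerivAt (x := x)).fderiv
    rw [h2, innerSL_apply_apply, real_inner_self_eq_norm_sq, he, one_pow]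
  have hq : Integrable fun x => ⟪e, x⟫ * (2 * u x * fderiv ℝ u x e) := by
    refine hint (by have := hu.continuous; fun_prop) ?_
    have h1 : (fun x => ⟪e, x⟫ * (2 * u x * fderiv ℝ u x e))
        = (fun x => ⟪e, x⟫ * 2 * fderiv ℝ u x e) * u := by
      ext x; simp only [Pi.mul_apply]; ring
    rw [h1]
    exact hc.mul_left
  have hparts := integral_mul_fderiv_eq_neg_fderiv_mul_of_integrable (μ := volume) (𝕜 := ℝ)
    (f := fun x : E => ⟪e, x⟫) (g := fun x => u x ^ 2) (v := e)
    (by simp only [hfe, one_mul]; exact hint (hu.continuous.pow 2) hc2)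
    (by simpa only [hfd] using hq)
    (hint (by have := hu.continuous; fun_prop) hc2.mul_left)
    (fun x _ => (innerSL ℝ e).differentiableAt)
    (fun x _ => (hu.differentiable one_ne_zero x).pow 2)
  simp only [hfe, hfd, one_mul] at hparts
  -- Young's inequality, using `|⟨e, x⟩| ≤ R` on the support.
  have hpt : ∀ x, -(⟪e, x⟫ * (2 * u x * fderiv ℝ u x e)) ≤
      1 / 2 * u x ^ 2 + 2 * R ^ 2 * ‖fderiv ℝ u x‖ ^ 2 := by
    intro x
    by_cases hx : u x = 0
    · simp only [hx]; simp; positivity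
    have h1 : |⟪e, x⟫| ≤ R := by
      refine (abs_real_inner_le_norm e x).trans ?_
      rw [he, one_mul]; exact hR x hx
    have h2 : |fderiv ℝ u x e| ≤ ‖fderiv ℝ u x‖ := by
      simpa [he] using (fderiv ℝ u x).le_opNorm e
    have h3 : |⟪e, x⟫ * fderiv ℝ u x e| ≤ R * ‖fderiv ℝ u x‖ := by
      rw [abs_mul]; gcongr; exact (abs_nonneg _).trans h1
    have h4 : (⟪e, x⟫ * fderiv ℝ u x e) ^ 2 ≤ (R * ‖fderiv ℝ u x‖) ^ 2 := by
      rw [← sq_abs]; gcongr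
    nlinarith [sq_nonneg (u x + 2 * (⟪e, x⟫ * fderiv ℝ u x e))]
  have hi1 : Integrable fun x => u x ^ 2 := hint (hu.continuous.pow 2) hc2
  have hi2 : Integrable fun x => ‖fderiv ℝ u x‖ ^ 2 := hint (hd.norm.pow 2) hcd2
  have h5 : ∫ x, u x ^ 2 ≤ ∫ x, (1 / 2 * u x ^ 2 + 2 * R ^ 2 * ‖fderiv ℝ u x‖ ^ 2) := by
    rw [← neg_neg (∫ x, u x ^ 2), ← hparts, ← integral_neg]
    exact integral_mono hq.neg ((hi1.const_mul _).add (hi2.const_mul _)) hpt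
  rw [integral_add (hi1.const_mul _) (hi2.const_mul _), integral_const_mul,
    integral_const_mul] at h5
  linarith

/-- Jensen's inequality for the square on `[0, 1]`. -/
theorem sq_integral_unitInterval_le {g : ℝ → ℝ} (hg : Continuous g) :
    (∫ s in (0 : ℝ)..1, g s) ^ 2 ≤ ∫ s in (0 : ℝ)..1, g s ^ 2 := by
  set c := ∫ s in (0 : ℝ)..1, g s with hc
  have h0 : 0 ≤ ∫ s in (0 : ℝ)..1, (g s - c) ^ 2 :=
    intervalIntegral.integral_nonneg zero_le_one fun _ _ => sq_nonneg _
  have h1 : ∫ s in (0 : ℝ)..1, (g s - c) ^ 2 = (∫ s in (0 : ℝ)..1, g s ^ 2) - c ^ 2 := by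
    have : (fun s => (g s - c) ^ 2) = fun s => (g s ^ 2 - 2 * c * g s) + c ^ 2 := by ext; ring
    rw [this, intervalIntegral.integral_add (Continuous.intervalIntegrable (by fun_prop) _ _)
      (Continuous.intervalIntegrable (by fun_prop) _ _),
      intervalIntegral.integral_sub (Continuous.intervalIntegrable (by fun_prop) _ _)
      (Continuous.intervalIntegrable (by fun_prop) _ _), intervalIntegral.integral_const_mul, ← hc]
    simp; ring
  linarith

/-- Translations are Lipschitz in `L²` on functions with square integrable gradient. -/
theorem integral_sq_translate_sub_le {u : E → ℝ} (hu : ContDiff ℝ 1 u) (hc : HasCompactSupport u)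
    (h : E) : ∫ x, (u (x + h) - u x) ^ 2 ≤ ‖h‖ ^ 2 * ∫ x, ‖fderiv ℝ u x‖ ^ 2 := by
  have hd : Continuous (fderiv ℝ u) := hu.continuous_fderiv one_ne_zero
  have hcd2 : HasCompactSupport (fun x => ‖fderiv ℝ u x‖ ^ 2) :=
    (hc.fderiv ℝ).comp_left (g := fun y => ‖y‖ ^ 2) (by simp)
  have hi : Integrable (fun x => ‖fderiv ℝ u x‖ ^ 2) :=
    (hd.norm.pow 2).integrable_of_hasCompactSupport hcd2
  -- Tonelli's theorem for the bound `|u(x + h) - u(x)|² ≤ ∫₀¹ |h|² |∇u(x + s h)|² ds`.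
  let k : E → ℝ → ℝ≥0∞ := fun x s => ENNReal.ofReal (‖h‖ ^ 2 * ‖fderiv ℝ u (x + s • h)‖ ^ 2)
  have hk : Continuous (Function.uncurry k) := by
    refine ENNReal.continuous_ofReal.comp ?_
    fun_prop
  have hpt : ∀ x, ENNReal.ofReal ((u (x + h) - u x) ^ 2) ≤ ∫⁻ s in Ioc (0 : ℝ) 1, k x s := by
    intro x
    have hder : ∀ s : ℝ, HasDerivAt (fun s : ℝ => u (x + s • h)) (fderiv ℝ u (x + s • h) h) s := by
      intro s
      have h1 : HasDerivAt (fun s : ℝ => x + s • h) h s := by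
        simpa using ((hasDerivAt_id s).smul_const h).const_add x
      exact (hu.differentiable one_ne_zero _).hasFDerivAt.comp_hasDerivAt s h1
    have hcont : Continuous fun s : ℝ => fderiv ℝ u (x + s • h) h := by fun_prop
    have hftc := intervalIntegral.integral_eq_sub_of_hasDerivAt (fun s _ => hder s)
      (hcont.intervalIntegrable 0 1)
    simp only [one_smul, zero_smul, add_zero] at hftc
    have hcont2 : Continuous fun s : ℝ => ‖h‖ ^ 2 * ‖fderiv ℝ u (x + s • h)‖ ^ 2 := by fun_prop
    have h2 : (u (x + h) - u x) ^ 2 ≤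
        ∫ s in (0 : ℝ)..1, ‖h‖ ^ 2 * ‖fderiv ℝ u (x + s • h)‖ ^ 2 := by
      rw [← hftc]
      refine (sq_integral_unitInterval_le hcont).trans ?_
      refine intervalIntegral.integral_mono_on zero_le_one ((hcont.pow 2).intervalIntegrable _ _)
        (hcont2.intervalIntegrable _ _) fun s _ => ?_
      rw [← mul_pow, mul_comm, ← sq_abs]
      gcongr
      exact (fderiv ℝ u (x + s • h)).le_opNorm h
    rw [intervalIntegral.integral_of_le zero_le_one] at h2
    refine (ENNReal.ofReal_le_ofReal h2).trans_eq ?_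
    exact ofReal_integral_eq_lintegral_ofReal
      ((intervalIntegrable_iff_integrableOn_Ioc_of_le zero_le_one).1
        (hcont2.intervalIntegrable _ _)) (ae_of_all _ fun s => by positivity)
  have hle : ∫⁻ x, ENNReal.ofReal ((u (x + h) - u x) ^ 2) ≤
      ENNReal.ofReal (‖h‖ ^ 2 * ∫ x, ‖fderiv ℝ u x‖ ^ 2) := by
    calc ∫⁻ x, ENNReal.ofReal ((u (x + h) - u x) ^ 2)
        ≤ ∫⁻ x, ∫⁻ s in Ioc (0 : ℝ) 1, k x s := lintegral_mono hpt
      _ = ∫⁻ s in Ioc (0 : ℝ) 1, ∫⁻ x, k x s := lintegral_lintegral_swap hk.aemeasurable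
      _ = ∫⁻ _s in Ioc (0 : ℝ) 1, ENNReal.ofReal (‖h‖ ^ 2 * ∫ x, ‖fderiv ℝ u x‖ ^ 2) := by
          refine lintegral_congr fun s => ?_
          rw [← integral_const_mul, ofReal_integral_eq_lintegral_ofReal (hi.const_mul _)
            (ae_of_all _ fun x => by positivity)]
          exact lintegral_add_right_eq_self
            (fun x => ENNReal.ofReal (‖h‖ ^ 2 * ‖fderiv ℝ u x‖ ^ 2)) (s • h)
      _ = _ := by simp
  rw [integral_eq_lintegral_of_nonneg_ae (ae_of_all _ fun x => sq_nonneg _)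
    (by have := hu.continuous; fun_prop :
      Continuous fun x => (u (x + h) - u x) ^ 2).aestronglyMeasurable]
  exact ENNReal.toReal_le_of_le_ofReal (by positivity) hle

end CompactSupport

/-! ### The space `H₀¹(Ω)` -/

section Domain

variable {d : ℕ} {Ω : Opens (Space d)}

instance (Ω : Opens (Space d)) : CompleteSpace (H01 Ω) :=
  (Submodule.isClosed_topologicalClosure _).completeSpace_coe

/-- A closed property of elements of `H₀¹(Ω)` may be checked on test functions. -/
theorem H01.induction {P : H01 Ω → Prop} (hP : IsClosed {w | P w})
    (h : ∀ (w : H01 Ω) (φ : 𝓓(Ω, ℝ)), (H01.val w : Space d → ℝ) =ᵐ[domMeasure Ω] φ →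
      (H01.grad w : Space d → Space d) =ᵐ[domMeasure Ω] (fun x => gradient φ x) → P w)
    (w : H01 Ω) : P w := by
  -- The test functions already form a subspace.
  let S : Submodule ℝ (WithLp 2 (L2 Ω × L2Vec Ω)) :=
    { carrier := {p | ∃ φ : 𝓓(Ω, ℝ), (p.fst : Space d → ℝ) =ᵐ[domMeasure Ω] (fun x => φ x) ∧
        (p.snd : Space d → Space d) =ᵐ[domMeasure Ω] (fun x => gradient (fun y => φ y) x)}
      zero_mem' := by
        refine ⟨0, ?_, ?_⟩
        · exact Lp.coeFn_zero ℝ 2 (domMeasure Ω)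
        · refine (Lp.coeFn_zero (Space d) 2 (domMeasure Ω)).trans (ae_of_all _ fun x => ?_)
          have : (fun y => (0 : 𝓓(Ω, ℝ)) y) = fun _ => (0 : ℝ) := rfl
          simp only [this, gradient_fun_const, Pi.zero_apply]
      add_mem' := by
        rintro p q ⟨φ, h1, h2⟩ ⟨ψ, h3, h4⟩
        refine ⟨φ + ψ, ?_, ?_⟩
        · filter_upwards [Lp.coeFn_add p.fst q.fst, h1, h3] with x h5 h6 h7
          rw [WithLp.add_fst, h5, Pi.add_apply, h6, h7]; rfl
        · filter_upwards [Lp.coeFn_add p.snd q.snd, h2, h4] with x h5 h6 h7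
          rw [WithLp.add_snd, h5, Pi.add_apply, h6, h7]
          have hφ := (φ.contDiff.differentiable (by simp) x)
          have hψ := (ψ.contDiff.differentiable (by simp) x)
          have : (fun y => (φ + ψ) y) = (φ : Space d → ℝ) + ψ := rfl
          rw [this, gradient, gradient, gradient, fderiv_add hφ hψ, map_add]
      smul_mem' := by
        rintro c p ⟨φ, h1, h2⟩
        refine ⟨c • φ, ?_, ?_⟩
        · filter_upwards [Lp.coeFn_smul c p.fst, h1] with x h5 h6
          rw [WithLp.smul_fst, h5, Pi.smul_apply, h6]; rfl
        · filter_upwards [Lp.coeFn_smul c p.snd, h2] with x h5 h6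
          rw [WithLp.smul_snd, h5, Pi.smul_apply, h6]
          have hφ := (φ.contDiff.differentiable (by simp) x)
          have : (fun y => (c • φ) y) = c • (φ : Space d → ℝ) := rfl
          rw [this, gradient, gradient, fderiv_const_smul hφ, map_smul] }
  have hS : H01Submodule Ω = S.topologicalClosure := by
    rw [H01Submodule]
    congr 1
    exact Submodule.span_eq S
  have hw : (w : WithLp 2 (L2 Ω × L2Vec Ω)) ∈ closure (S : Set (WithLp 2 (L2 Ω × L2Vec Ω))) := by
    rw [← Submodule.topologicalClosure_coe, ← hS]; exact w.2
  obtain ⟨x, hxS, hx⟩ := mem_closure_iff_seq_limit.1 hw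
  have hxm : ∀ n, x n ∈ H01Submodule Ω := fun n => hS ▸ S.le_topologicalClosure (hxS n)
  have hx' : Tendsto (fun n => (⟨x n, hxm n⟩ : H01 Ω)) atTop (𝓝 w) := tendsto_subtype_rng.2 hx
  refine hP.mem_of_tendsto hx' (Eventually.of_forall fun n => ?_)
  obtain ⟨φ, h1, h2⟩ := hxS n
  exact h _ φ h1 h2

theorem H01.sq_norm (w : H01 Ω) : ‖w‖ ^ 2 = ‖H01.val w‖ ^ 2 + ‖H01.grad w‖ ^ 2 :=
  WithLp.prod_norm_sq_eq_of_L2 (w : WithLp 2 (L2 Ω × L2Vec Ω))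

theorem H01.norm_val_le (w : H01 Ω) : ‖H01.val w‖ ≤ ‖w‖ :=
  le_of_sq_le_sq (by rw [H01.sq_norm]; linarith [sq_nonneg ‖H01.grad w‖]) (norm_nonneg _)

theorem H01.norm_grad_le (w : H01 Ω) : ‖H01.grad w‖ ≤ ‖w‖ :=
  le_of_sq_le_sq (by rw [H01.sq_norm]; linarith [sq_nonneg ‖H01.val w‖]) (norm_nonneg _)

theorem TestFunction.eq_zero_of_notMem (φ : 𝓓(Ω, ℝ)) {x : Space d} (hx : x ∉ Ω) : φ x = 0 :=
  image_eq_zero_of_notMem_tsupport fun h => hx (φ.tsupport_subset h)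

theorem TestFunction.fderiv_eq_zero_of_notMem (φ : 𝓓(Ω, ℝ)) {x : Space d} (hx : x ∉ Ω) :
    fderiv ℝ φ x = 0 :=
  image_eq_zero_of_notMem_tsupport fun h => hx (φ.tsupport_subset (tsupport_fderiv_subset ℝ h))

theorem H01.sq_norm_val_eq {w : H01 Ω} {φ : 𝓓(Ω, ℝ)}
    (h : (H01.val w : Space d → ℝ) =ᵐ[domMeasure Ω] φ) : ‖H01.val w‖ ^ 2 = ∫ x, φ x ^ 2 := by
  rw [sq_norm_eq_integral, ← setIntegral_eq_integral_of_forall_compl_eq_zero (s := (Ω : Set _))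
    (f := fun x => φ x ^ 2) (fun x hx => by rw [TestFunction.eq_zero_of_notMem φ hx]; simp)]
  refine integral_congr_ae (h.mono fun x hx => ?_)
  simp only [hx, Real.norm_eq_abs, sq_abs]

theorem H01.sq_norm_grad_eq {w : H01 Ω} {φ : 𝓓(Ω, ℝ)}
    (h : (H01.grad w : Space d → Space d) =ᵐ[domMeasure Ω] (fun x => gradient φ x)) :
    ‖H01.grad w‖ ^ 2 = ∫ x, ‖fderiv ℝ φ x‖ ^ 2 := by
  rw [sq_norm_eq_integral, ← setIntegral_eq_integral_of_forall_compl_eq_zero (s := (Ω : Set _))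
    (f := fun x => ‖fderiv ℝ φ x‖ ^ 2)
    (fun x hx => by rw [TestFunction.fderiv_eq_zero_of_notMem φ hx]; simp)]
  refine integral_congr_ae (h.mono fun x hx => ?_)
  simp only [hx, gradient, LinearIsometryEquiv.norm_map]

/-- The Poincaré inequality on `H₀¹(Ω)`. -/
theorem H01.exists_norm_val_le (hd : 1 ≤ d) (hΩ : Bornology.IsBounded (Ω : Set (Space d))) :
    ∃ R : ℝ, ∀ w : H01 Ω, ‖H01.val w‖ ^ 2 ≤ 4 * R ^ 2 * ‖H01.grad w‖ ^ 2 := by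
  obtain ⟨R, hR⟩ := hΩ.subset_closedBall (0 : Space d)
  refine ⟨R, H01.induction (isClosed_le (by fun_prop) (by fun_prop)) fun w φ h1 h2 => ?_⟩
  rw [H01.sq_norm_val_eq h1, H01.sq_norm_grad_eq h2]
  refine integral_sq_le_integral_sq_fderiv (e := EuclideanSpace.single (⟨0, hd⟩ : Fin d) (1 : ℝ))
    (by simp) (φ.contDiff.of_le (by simp)) φ.hasCompactSupport fun x hx => ?_
  have : x ∈ Ω := by
    by_contra hx'
    exact hx (TestFunction.eq_zero_of_notMem φ hx')
  simpa using hR this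

/-- The Dirichlet form is coercive on `H₀¹(Ω)`. -/
theorem H01.exists_norm_le_grad (hd : 1 ≤ d) (hΩ : Bornology.IsBounded (Ω : Set (Space d))) :
    ∃ C : NNReal, ∀ w : H01 Ω, ‖w‖ ≤ C * ‖H01.grad w‖ := by
  obtain ⟨R, hR⟩ := H01.exists_norm_val_le hd hΩ
  refine ⟨NNReal.sqrt (4 * R ^ 2 + 1).toNNReal, fun w => ?_⟩
  have h0 : 0 ≤ 4 * R ^ 2 + 1 := by positivity
  refine le_of_sq_le_sq ?_ (by positivity)
  rw [mul_pow, ← NNReal.coe_pow, NNReal.sq_sqrt, Real.coe_toNNReal _ h0, H01.sq_norm]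
  linarith [hR w]

/-- An isomorphism of `H₀¹(Ω)` onto a Hilbert space that turns the Dirichlet form `∫ ∇z · ∇w` into
the inner product; the Hilbert space is the space of gradients. -/
theorem H01.exists_equiv (hd : 1 ≤ d) (hΩ : Bornology.IsBounded (Ω : Set (Space d))) :
    ∃ (G : Submodule ℝ (L2Vec Ω)) (_ : CompleteSpace G) (e : H01 Ω ≃L[ℝ] G),
      ∀ z w, ⟪e z, e w⟫ = ⟪H01.grad z, H01.grad w⟫ := by
  obtain ⟨C, hC⟩ := H01.exists_norm_le_grad hd hΩ
  have hanti : AntilipschitzWith C (H01.grad (Ω := Ω)) :=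
    AddMonoidHomClass.antilipschitz_of_bound _ hC
  have hcl : IsClosed (range (H01.grad (Ω := Ω))) :=
    hanti.isClosed_range (H01.grad (Ω := Ω)).uniformContinuous
  refine ⟨(H01.grad (Ω := Ω)).range, ?_, (H01.grad (Ω := Ω)).equivRange hanti.injective hcl,
    fun z w => ?_⟩
  · exact hcl.completeSpace_coe
  · rfl

end Domain

/-! ### Compactness of the embedding `L²(Ω) → H⁻¹(Ω)` -/

section Rellich

variable {d : ℕ} {Ω : Opens (Space d)}

theorem isFiniteMeasure_domMeasure (hΩ : Bornology.IsBounded (Ω : Set (Space d))) :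
    IsFiniteMeasure (domMeasure Ω) :=
  isFiniteMeasure_restrict.2 hΩ.measure_lt_top.ne

/-- The local integrals `y ↦ ∫_{Ω ∩ B(y, ε)} f`; after division by the volume of the ball, this is a
mollification of `f`. -/
noncomputable def localIntegral (ε : ℝ) (f : L2 Ω) (y : Space d) : ℝ :=
  ∫ x in Metric.ball y ε, f x ∂(domMeasure Ω)

theorem measurableSet_dist_lt (ε : ℝ) :
    MeasurableSet {p : Space d × Space d | dist p.1 p.2 < ε} :=
  measurableSet_lt (by fun_prop) measurable_const

theorem localIntegral_eq (ε : ℝ) (f : L2 Ω) (y : Space d) :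
    localIntegral ε f y = ∫ x, {p : Space d × Space d | dist p.1 p.2 < ε}.indicator
      (fun p => f p.1) (x, y) ∂(domMeasure Ω) := by
  rw [localIntegral, ← integral_indicator Metric.isOpen_ball.measurableSet]
  rfl

theorem integrable_L2 [IsFiniteMeasure (domMeasure Ω)] (f : L2 Ω) : Integrable f (domMeasure Ω) :=
  (Lp.memLp f).integrable (by norm_num)

theorem abs_localIntegral_le [IsFiniteMeasure (domMeasure Ω)] (ε : ℝ) (f : L2 Ω) (y : Space d) :
    |localIntegral ε f y| ≤ √((domMeasure Ω).real univ) * ‖f‖ :=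
  calc |localIntegral ε f y| ≤ ∫ x in Metric.ball y ε, ‖f x‖ ∂(domMeasure Ω) := by
        rw [localIntegral, ← Real.norm_eq_abs]
        exact norm_integral_le_integral_norm _
    _ ≤ ∫ x, ‖f x‖ ∂(domMeasure Ω) :=
        setIntegral_le_integral (integrable_L2 f).norm (ae_of_all _ fun _ => norm_nonneg _)
    _ ≤ _ := integral_norm_le_of_isFiniteMeasure f

theorem memLp_localIntegral [IsFiniteMeasure (domMeasure Ω)] (ε : ℝ) (f : L2 Ω) :
    MemLp (localIntegral ε f) 2 (domMeasure Ω) := by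
  refine MemLp.of_bound ?_ (√((domMeasure Ω).real univ) * ‖f‖)
    (ae_of_all _ fun y => abs_localIntegral_le ε f y)
  have h1 : Integrable (fun p : Space d × Space d => f p.1)
      ((domMeasure Ω).prod (domMeasure Ω)) := by
    simpa using (integrable_L2 f).mul_prod (integrable_const (1 : ℝ) (μ := domMeasure Ω))
  refine (h1.indicator (measurableSet_dist_lt ε)).integral_prod_right.1.congr (ae_of_all _ ?_)
  intro y
  exact (localIntegral_eq ε f y).symm

/-- Mollification at scale `ε` changes the pairing with a test function by at most `ε` times the
norm of its gradient. -/
theorem abs_integral_mul_sub_le [IsFiniteMeasure (domMeasure Ω)] {ε : ℝ} (hε : 0 < ε) (f : L2 Ω)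
    (φ : 𝓓(Ω, ℝ)) :
    |volume.real (Metric.ball (0 : Space d) ε) * (∫ x, f x * φ x ∂(domMeasure Ω))
        - ∫ y, localIntegral ε f y * φ y ∂(domMeasure Ω)| ≤
      volume.real (Metric.ball (0 : Space d) ε) * (ε * ‖f‖ * √(∫ x, ‖fderiv ℝ φ x‖ ^ 2)) := by
  set μ := domMeasure Ω with hμ
  set B := Metric.ball (0 : Space d) ε with hB
  have hBfin : volume B < ⊤ := Metric.isBounded_ball.measure_lt_top
  have : IsFiniteMeasure (volume.restrict B) := isFiniteMeasure_restrict.2 hBfin.ne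
  have hf := integrable_L2 f
  have hφc : Continuous φ := φ.continuous
  obtain ⟨M, hM⟩ := hφc.bounded_above_of_compact_support φ.hasCompactSupport
  have hφi : Integrable φ μ := Integrable.of_bound hφc.aestronglyMeasurable M (ae_of_all _ hM)
  have hφv : Integrable φ := hφc.integrable_of_hasCompactSupport φ.hasCompactSupport
  -- The mollified pairing as an integral over translations.
  have h1 : ∫ y, localIntegral ε f y * φ y ∂μ = ∫ x, f x * (∫ h in B, φ (x + h)) ∂μ := by
    have hK := (hf.mul_prod hφi).indicator (measurableSet_dist_lt (d := d) ε)
    calc ∫ y, localIntegral ε f y * φ y ∂μ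
        = ∫ y, ∫ x, {p : Space d × Space d | dist p.1 p.2 < ε}.indicator
            (fun p => f p.1 * φ p.2) (x, y) ∂μ ∂μ := by
          refine integral_congr_ae (ae_of_all _ fun y => ?_)
          simp only
          rw [localIntegral_eq, ← integral_mul_const]
          refine integral_congr_ae (ae_of_all _ fun x => ?_)
          simp only [indicator]
          split_ifs <;> simp
      _ = ∫ x, ∫ y, {p : Space d × Space d | dist p.1 p.2 < ε}.indicator
            (fun p => f p.1 * φ p.2) (x, y) ∂μ ∂μ := (integral_integral_swap (f := fun x y =>
              {p : Space d × Space d | dist p.1 p.2 < ε}.indicator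
              (fun p => f p.1 * φ p.2) (x, y)) hK).symm
      _ = ∫ x, f x * (∫ h in B, φ (x + h)) ∂μ := by
          refine integral_congr_ae (ae_of_all _ fun x => ?_)
          simp only
          have h2 : ∀ y, {p : Space d × Space d | dist p.1 p.2 < ε}.indicator
              (fun p => f p.1 * φ p.2) (x, y) = f x * (Metric.ball x ε).indicator φ y := by
            intro y
            simp only [indicator, mem_ofPred_eq, Metric.mem_ball, dist_comm x y]
            split_ifs <;> simp
          simp_rw [h2]
          rw [integral_const_mul]
          congr 1
          rw [hμ, setIntegral_eq_integral_of_forall_compl_eq_zero (fun y hy => by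
            simp [indicator, TestFunction.eq_zero_of_notMem φ hy]),
            ← integral_indicator Metric.isOpen_ball.measurableSet,
            ← integral_add_left_eq_self _ x]
          refine integral_congr_ae (ae_of_all _ fun h => ?_)
          simp [indicator]
  have hprod : Integrable (fun p : Space d × Space d => f p.1 * (φ p.1 - φ (p.1 + p.2)))
      (μ.prod (volume.restrict B)) := by
    have h3 : Integrable (fun p : Space d × Space d => f p.1) (μ.prod (volume.restrict B)) := by
      simpa using hf.mul_prod (integrable_const (1 : ℝ) (μ := volume.restrict B))
    refine h3.mul_bdd (c := M + M) (by fun_prop : Continuous fun p : Space d × Space d =>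
      φ p.1 - φ (p.1 + p.2)).aestronglyMeasurable (ae_of_all _ fun p => ?_)
    exact (norm_sub_le _ _).trans (add_le_add (hM _) (hM _))
  have hφB : ∀ x, Integrable (fun h => φ (x + h)) (volume.restrict B) := fun x =>
    (hφv.comp_add_left x).restrict
  have h4 : volume.real B * (∫ x, f x * φ x ∂μ) - ∫ y, localIntegral ε f y * φ y ∂μ
      = ∫ h in B, (∫ x, f x * (φ x - φ (x + h)) ∂μ) := by
    rw [← integral_integral_swap hprod, h1, ← integral_const_mul, ← integral_sub]
    · refine integral_congr_ae (ae_of_all _ fun x => ?_)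
      simp only
      rw [integral_const_mul, integral_sub (integrable_const _) (hφB x), integral_const,
        measureReal_restrict_apply_univ, smul_eq_mul]
      ring
    · exact (hf.mul_bdd (c := M) hφc.aestronglyMeasurable (ae_of_all _ hM)).const_mul _
    · refine hf.mul_bdd (c := M * volume.real B) ?_ (ae_of_all _ fun x => ?_)
      · exact (StronglyMeasurable.integral_prod_right (f := fun x h => φ (x + h))
          (by fun_prop : Continuous fun p : Space d × Space d =>
            φ (p.1 + p.2)).stronglyMeasurable).aestronglyMeasurable
      · exact norm_setIntegral_le_of_norm_le_const hBfin fun h _ => hM _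
  -- Each translation by `‖h‖ ≤ ε` changes the pairing by at most `ε ‖f‖ ‖∇φ‖`.
  rw [h4, mul_comm (volume.real B), ← Real.norm_eq_abs]
  refine norm_setIntegral_le_of_norm_le_const hBfin fun h hh => ?_
  have hh' : ‖h‖ ≤ ε := by simpa [hB] using (mem_ball_zero_iff.1 hh).le
  have hcont : Continuous fun x => |φ x - φ (x + h)| := by fun_prop
  have hρ : MemLp (fun x => |φ x - φ (x + h)|) 2 μ :=
    MemLp.of_bound hcont.aestronglyMeasurable (M + M) (ae_of_all _ fun x => by
      rw [Real.norm_eq_abs, abs_abs]; exact (norm_sub_le _ _).trans (add_le_add (hM _) (hM _)))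
  calc ‖∫ x, f x * (φ x - φ (x + h)) ∂μ‖
      ≤ ∫ x, ‖f x * (φ x - φ (x + h))‖ ∂μ := norm_integral_le_integral_norm _
    _ = ∫ x, |φ x - φ (x + h)| * ‖f x‖ ∂μ := by
        refine integral_congr_ae (ae_of_all _ fun x => ?_)
        simp only
        rw [norm_mul, mul_comm, Real.norm_eq_abs (φ x - φ (x + h))]
    _ ≤ √(∫ x, |φ x - φ (x + h)| ^ 2 ∂μ) * ‖f‖ :=
        integral_mul_norm_le hρ (ae_of_all _ fun _ => abs_nonneg _) f
    _ ≤ (ε * √(∫ x, ‖fderiv ℝ φ x‖ ^ 2)) * ‖f‖ := by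
        gcongr
        rw [Real.sqrt_le_left (by positivity), mul_pow, Real.sq_sqrt
          (integral_nonneg fun _ => by positivity)]
        have h5 := integral_sq_translate_sub_le (φ.contDiff.of_le (by simp) : ContDiff ℝ 1 φ)
          φ.hasCompactSupport h
        have h6 : Integrable (fun x => (φ (x + h) - φ x) ^ 2) := by
          refine Continuous.integrable_of_hasCompactSupport (by fun_prop) ?_
          refine HasCompactSupport.comp_left (g := fun y : ℝ => y ^ 2) ?_ (by simp)
          exact (φ.hasCompactSupport.comp_homeomorph (Homeomorph.addRight h)).sub
            φ.hasCompactSupport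
        calc ∫ x, |φ x - φ (x + h)| ^ 2 ∂μ = ∫ x, (φ (x + h) - φ x) ^ 2 ∂μ := by
              refine integral_congr_ae (ae_of_all _ fun x => ?_)
              simp only
              rw [sq_abs]; ring
          _ ≤ ∫ x, (φ (x + h) - φ x) ^ 2 :=
              setIntegral_le_integral h6 (ae_of_all _ fun _ => sq_nonneg _)
          _ ≤ _ := h5.trans (by gcongr)
    _ = _ := by ring

end Rellich

section Compactness

variable {d : ℕ} {Ω : Opens (Space d)}

/-- The dual norm of `f` is at most the `L²` norm of its mollification plus `ε ‖f‖`. -/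
theorem norm_toHneg1_le [IsFiniteMeasure (domMeasure Ω)] {ε : ℝ} (hε : 0 < ε) (f : L2 Ω) :
    ‖L2.toHneg1 f‖ ≤ (volume.real (Metric.ball (0 : Space d) ε))⁻¹ *
      ‖(memLp_localIntegral ε f).toLp _‖ + ε * ‖f‖ := by
  set F : L2 Ω := (memLp_localIntegral ε f).toLp _ with hF
  set b := volume.real (Metric.ball (0 : Space d) ε) with hb
  have hb0 : 0 < b := ENNReal.toReal_pos (Metric.measure_ball_pos volume _ hε).ne'
    Metric.isBounded_ball.measure_lt_top.ne
  have key : ∀ w : H01 Ω, |b * ⟪f, H01.val w⟫ - ⟪F, H01.val w⟫| ≤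
      b * (ε * ‖f‖ * ‖H01.grad w‖) := by
    refine H01.induction (isClosed_le (by fun_prop) (by fun_prop)) fun w φ h1 h2 => ?_
    have h3 := abs_integral_mul_sub_le hε f φ
    rw [← H01.sq_norm_grad_eq h2, Real.sqrt_sq (norm_nonneg _)] at h3
    convert h3 using 4
    · rw [L2.inner_def]
      refine integral_congr_ae (h1.mono fun x hx => ?_)
      simp only [hx]
      exact mul_comm _ _
    · rw [L2.inner_def]
      refine integral_congr_ae ?_
      filter_upwards [h1, (memLp_localIntegral ε f).coeFn_toLp] with x hx hx'
      rw [hF, hx, hx']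
      exact mul_comm _ _
  refine ContinuousLinearMap.opNorm_le_bound _ (by positivity) fun w => ?_
  change ‖⟪f, H01.val w⟫‖ ≤ _
  have h1 := key w
  have h2 := abs_real_inner_le_norm F (H01.val w)
  have h3 : b * |⟪f, H01.val w⟫| ≤ b * (ε * ‖f‖ * ‖w‖) + ‖F‖ * ‖w‖ := by
    rw [← abs_of_pos hb0, ← abs_mul, abs_of_pos hb0]
    calc |b * ⟪f, H01.val w⟫| = |(b * ⟪f, H01.val w⟫ - ⟪F, H01.val w⟫) + ⟪F, H01.val w⟫| := by
          rw [sub_add_cancel]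
      _ ≤ b * (ε * ‖f‖ * ‖H01.grad w‖) + ‖F‖ * ‖H01.val w‖ :=
          (abs_add_le _ _).trans (add_le_add h1 h2)
      _ ≤ _ := by
          gcongr
          · exact H01.norm_grad_le w
          · exact H01.norm_val_le w
  rw [Real.norm_eq_abs, ← mul_le_mul_iff_right₀ hb0]
  refine h3.trans_eq ?_
  field_simp
  ring

/-- Rellich's theorem in dual form: the embedding `L²(Ω) → H⁻¹(Ω)` maps weakly convergent sequences
to norm convergent ones. -/
theorem tendsto_norm_toHneg1 (hΩ : Bornology.IsBounded (Ω : Set (Space d))) {f : ℕ → L2 Ω} {M : ℝ}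
    (hM : ∀ n, ‖f n‖ ≤ M) (hf : WeaklyConverges f 0) :
    Tendsto (fun n => ‖L2.toHneg1 (f n)‖) atTop (𝓝 0) := by
  have := isFiniteMeasure_domMeasure hΩ
  have hM0 : 0 ≤ M := (norm_nonneg _).trans (hM 0)
  -- At fixed `ε` the mollifications converge pointwise and boundedly, hence in `L²(Ω)`.
  have hloc : ∀ ε : ℝ, Tendsto (fun n => ‖(memLp_localIntegral ε (f n)).toLp _‖) atTop (𝓝 0) := by
    intro ε
    have h1 : Tendsto (fun n => ∫ y, localIntegral ε (f n) y ^ 2 ∂(domMeasure Ω)) atTop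
        (𝓝 (∫ _y, (0 : ℝ) ^ 2 ∂(domMeasure Ω))) := by
      refine tendsto_integral_of_dominated_convergence
        (fun _ => (√((domMeasure Ω).real univ) * M) ^ 2)
        (fun n => (memLp_localIntegral ε (f n)).1.pow 2) (integrable_const _)
        (fun n => ae_of_all _ fun y => ?_) (ae_of_all _ fun y => ?_)
      · rw [norm_pow, Real.norm_eq_abs]
        gcongr
        exact (abs_localIntegral_le ε (f n) y).trans (by gcongr; exact hM n)
      · have h2 := hf (innerSL ℝ (indicatorConstLp 2
          (Metric.isOpen_ball (x := y) (ε := ε)).measurableSet (measure_ne_top (domMeasure Ω) _)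
          (1 : ℝ)))
        simp only [innerSL_apply_apply, L2.inner_indicatorConstLp_one, inner_zero_right] at h2
        exact h2.pow 2
    have h3 : ∀ n, ‖(memLp_localIntegral ε (f n)).toLp _‖ =
        √(∫ y, localIntegral ε (f n) y ^ 2 ∂(domMeasure Ω)) := by
      intro n
      rw [eq_comm, Real.sqrt_eq_iff_eq_sq (integral_nonneg fun _ => sq_nonneg _) (norm_nonneg _),
        sq_norm_eq_integral]
      refine integral_congr_ae ?_
      filter_upwards [(memLp_localIntegral ε (f n)).coeFn_toLp] with y hy
      rw [hy, Real.norm_eq_abs, sq_abs]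
    simp only [h3]
    simpa using h1.sqrt
  refine Metric.tendsto_atTop.2 fun η hη => ?_
  set ε := η / (2 * (M + 1)) with hε
  have hε0 : 0 < ε := by positivity
  have h1 := (hloc ε).const_mul (volume.real (Metric.ball (0 : Space d) ε))⁻¹
  rw [mul_zero] at h1
  obtain ⟨N, hN⟩ := eventually_atTop.1 (h1.eventually_lt_const (half_pos hη))
  refine ⟨N, fun n hn => ?_⟩
  rw [Real.dist_0_eq_abs]
  refine (abs_of_nonneg (norm_nonneg (L2.toHneg1 (f n)))).trans_lt ?_
  calc ‖L2.toHneg1 (f n)‖ ≤ _ := norm_toHneg1_le hε0 (f n)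
    _ < η / 2 + ε * M := by
        refine add_lt_add_of_lt_of_le (hN n hn) (by gcongr; exact hM n)
    _ ≤ η / 2 + ε * (M + 1) := by gcongr; linarith
    _ = η := by rw [hε]; field_simp; ring

/-! ### Compatible loads and the dissipation -/

theorem eLpNorm_top_le_one_iff {f : L2 Ω} :
    eLpNorm f ∞ (domMeasure Ω) ≤ 1 ↔ ∀ᵐ x ∂(domMeasure Ω), |f x| ≤ 1 := by
  rw [eLpNorm_exponent_top]
  constructor
  · intro h
    filter_upwards [ae_le_eLpNormEssSup (f := f) (μ := domMeasure Ω)] with x hx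
    have := hx.trans h
    rwa [Real.enorm_eq_ofReal_abs, ENNReal.ofReal_le_one] at this
  · intro h
    refine (eLpNormEssSup_le_of_ae_bound (C := 1) h).trans (by simp)

/-- The unit ball of `L^∞(Ω)` is weakly closed in `L²(Ω)`. -/
theorem ae_abs_le_one_of_weaklyConverges [IsFiniteMeasure (domMeasure Ω)] {f : ℕ → L2 Ω}
    {f₀ : L2 Ω} (hf : WeaklyConverges f f₀) (h : ∀ n, ∀ᵐ x ∂(domMeasure Ω), |f n x| ≤ 1) :
    ∀ᵐ x ∂(domMeasure Ω), |f₀ x| ≤ 1 := by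
  have hset : ∀ s, MeasurableSet s → Tendsto (fun n => ∫ x in s, f n x ∂(domMeasure Ω)) atTop
      (𝓝 (∫ x in s, f₀ x ∂(domMeasure Ω))) := by
    intro s hs
    have h2 := hf (innerSL ℝ (indicatorConstLp 2 hs (measure_ne_top (domMeasure Ω) _) (1 : ℝ)))
    simpa only [innerSL_apply_apply, L2.inner_indicatorConstLp_one] using h2
  have hup := ae_le_of_forall_setIntegral_le (integrable_L2 f₀) (integrable_const (1 : ℝ))
    fun s hs _ => le_of_tendsto' (hset s hs) fun n =>
      setIntegral_mono_ae (integrable_L2 (f n)).integrableOn (integrable_const _).integrableOn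
        ((h n).mono fun x hx => (abs_le.1 hx).2)
  have hlow := ae_le_of_forall_setIntegral_le (integrable_const (-1 : ℝ)) (integrable_L2 f₀)
    fun s hs _ => ge_of_tendsto' (hset s hs) fun n =>
      setIntegral_mono_ae (integrable_const _).integrableOn (integrable_L2 (f n)).integrableOn
        ((h n).mono fun x hx => (abs_le.1 hx).1)
  filter_upwards [hup, hlow] with x h1 h2
  exact abs_le.2 ⟨h2, h1⟩

/-- The dissipation as a continuous seminorm. -/
theorem exists_dissipation_seminorm [IsFiniteMeasure (domMeasure Ω)] :
    ∃ D : Seminorm ℝ (H01 Ω), Continuous D ∧ ∀ w, D w = dissipation w := by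
  refine ⟨Seminorm.of dissipation ?_ ?_, ?_, fun w => rfl⟩
  · intro v w
    simp only [dissipation]
    rw [← integral_add (integrable_L2 _).abs (integrable_L2 _).abs]
    refine integral_mono_ae (integrable_L2 _).abs
      ((integrable_L2 _).abs.add (integrable_L2 _).abs) ?_
    rw [map_add]
    filter_upwards [Lp.coeFn_add (H01.val v) (H01.val w)] with x hx
    rw [hx]
    exact abs_add_le _ _
  · intro c v
    simp only [dissipation]
    rw [← integral_const_mul, map_smul]
    refine integral_congr_ae ?_
    filter_upwards [Lp.coeFn_smul c (H01.val v)] with x hx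
    rw [hx]
    exact abs_mul _ _
  · refine seminorm_continuous_of_le_mul_norm _ (√((domMeasure Ω).real univ)) fun w => ?_
    exact (integral_norm_le_of_isFiniteMeasure (H01.val w)).trans
      (by gcongr; exact H01.norm_val_le w)

end Compactness

/-! ### The space `H¹(I; H)` -/

section BochnerH1

variable {T : ℝ} {H : Type*} [NormedAddCommGroup H] [NormedSpace ℝ H]

theorem BochnerH1.fn_ae_eq (u : BochnerH1 T H) :
    ∀ᵐ t ∂(volume.restrict (Ioo (0 : ℝ) T)), u.fn t = u.initialValue + primitive u.deriv t :=
  u.2.choose_spec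

theorem exists_of_ae_Ioo (hT : 0 < T) {p : ℝ → Prop}
    (h : ∀ᵐ t ∂(volume.restrict (Ioo (0 : ℝ) T)), p t) : ∃ t ∈ Ioo (0 : ℝ) T, p t := by
  have : (ae (volume.restrict (Ioo (0 : ℝ) T))).NeBot := by
    rw [ae_restrict_neBot]; simp [hT]
  exact (ae_mem_Ioo.and h).exists

theorem BochnerH1.initialValue_eq (hT : 0 < T) (u : BochnerH1 T H) {a : H}
    (h : ∀ᵐ t ∂(volume.restrict (Ioo (0 : ℝ) T)), u.fn t = a + primitive u.deriv t) :
    u.initialValue = a := by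
  obtain ⟨t, -, h1, h2⟩ := exists_of_ae_Ioo hT (u.fn_ae_eq.and h)
  exact add_right_cancel (h1.symm.trans h2)

theorem BochnerH1.ext_of_initialValue_deriv {u v : BochnerH1 T H}
    (h0 : u.initialValue = v.initialValue) (h1 : u.deriv = v.deriv) : u = v := by
  have hfn : u.fn = v.fn := by
    refine Lp.ext ?_
    filter_upwards [u.fn_ae_eq, v.fn_ae_eq] with t hu hv
    rw [hu, hv, h0, h1]
  exact Subtype.ext (WithLp.ofLp_injective 2 (Prod.ext hfn h1))

theorem BochnerH1.exists_of_deriv (hT : 0 < T) (a : H) (v : BochnerL2 T H) :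
    ∃ u : BochnerH1 T H, u.initialValue = a ∧ u.deriv = v := by
  have hm := memLp_const_add_primitive a v
  let u : BochnerH1 T H := ⟨WithLp.toLp 2 (hm.toLp _, v), a, hm.coeFn_toLp⟩
  exact ⟨u, u.initialValue_eq hT hm.coeFn_toLp, rfl⟩

theorem BochnerH1.sq_norm (u : BochnerH1 T H) : ‖u‖ ^ 2 = ‖u.fn‖ ^ 2 + ‖u.deriv‖ ^ 2 :=
  WithLp.prod_norm_sq_eq_of_L2 (u : WithLp 2 (BochnerL2 T H × BochnerL2 T H))

theorem BochnerH1.norm_fn_le (u : BochnerH1 T H) : ‖u.fn‖ ≤ ‖u‖ :=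
  le_of_sq_le_sq (by rw [u.sq_norm]; linarith [sq_nonneg ‖u.deriv‖]) (norm_nonneg _)

theorem BochnerH1.norm_deriv_le (u : BochnerH1 T H) : ‖u.deriv‖ ≤ ‖u‖ :=
  le_of_sq_le_sq (by rw [u.sq_norm]; linarith [sq_nonneg ‖u.fn‖]) (norm_nonneg _)

theorem BochnerH1.toContinuousMap_apply (u : BochnerH1 T H) (t : Icc (0 : ℝ) T) :
    u.toContinuousMap t = u.initialValue + primitive u.deriv t := rfl

theorem BochnerH1.norm_initialValue_le (hT : 0 < T) (u : BochnerH1 T H) :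
    ‖u.initialValue‖ ≤ (T⁻¹ * √T + √T) * ‖u‖ := by
  -- The initial value is bounded by the average of `‖u(t)‖` plus a bound for the primitive.
  have h1 : T * ‖u.initialValue‖ ≤ √T * ‖u.fn‖ + T * (√T * ‖u.deriv‖) := by
    have hi : Integrable (fun t => ‖u.fn t‖) (volume.restrict (Ioo (0 : ℝ) T)) :=
      ((Lp.memLp u.fn).integrable (by norm_num)).norm
    have h2 : ∫ _t in Ioo (0 : ℝ) T, ‖u.initialValue‖ ≤
        ∫ t in Ioo (0 : ℝ) T, (‖u.fn t‖ + √T * ‖u.deriv‖) := by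
      refine integral_mono_ae (integrable_const _) (hi.add (integrable_const _)) ?_
      filter_upwards [u.fn_ae_eq, ae_mem_Ioo] with t ht htI
      have h3 : u.initialValue = u.fn t - primitive u.deriv t := by rw [ht, add_sub_cancel_right]
      rw [h3]
      exact (norm_sub_le _ _).trans
        (add_le_add_right (norm_primitive_le u.deriv (Ioo_subset_Icc_self htI)) _)
    rw [integral_add hi (integrable_const _), setIntegral_const, setIntegral_const, Measure.real,
      Real.volume_Ioo, sub_zero, ENNReal.toReal_ofReal hT.le, smul_eq_mul, smul_eq_mul] at h2
    linarith [integral_norm_le u.fn]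
  rw [← mul_le_mul_iff_right₀ hT]
  calc T * ‖u.initialValue‖ ≤ √T * ‖u.fn‖ + T * (√T * ‖u.deriv‖) := h1
    _ ≤ √T * ‖u‖ + T * (√T * ‖u‖) := by
        gcongr
        · exact u.norm_fn_le
        · exact u.norm_deriv_le
    _ = _ := by field_simp

/-- Evaluation at a fixed time is a bounded linear map on `H¹(I; H)`, with a bound that is uniform
in time. -/
theorem BochnerH1.exists_evaluation (hT : 0 < T) (H : Type*) [NormedAddCommGroup H]
    [NormedSpace ℝ H] : ∃ C : ℝ, ∀ t ∈ Icc (0 : ℝ) T, ∃ L : BochnerH1 T H →L[ℝ] H,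
      (∀ u, L u = u.initialValue + primitive u.deriv t) ∧ ∀ u, ‖L u‖ ≤ C * ‖u‖ := by
  refine ⟨(T⁻¹ * √T + √T) + √T, fun t ht => ?_⟩
  have hb : ∀ u : BochnerH1 T H, ‖u.initialValue + primitive u.deriv t‖ ≤
      ((T⁻¹ * √T + √T) + √T) * ‖u‖ := by
    intro u
    rw [add_mul]
    refine (norm_add_le _ _).trans (add_le_add (u.norm_initialValue_le hT) ?_)
    exact (norm_primitive_le _ ht).trans (by gcongr; exact u.norm_deriv_le)
  refine ⟨LinearMap.mkContinuous
    { toFun := fun u => u.initialValue + primitive u.deriv t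
      map_add' := fun u v => ?_
      map_smul' := fun c u => ?_ } _ hb, fun u => rfl, hb⟩
  · have hd : (u + v).deriv = u.deriv + v.deriv := rfl
    have h0 : (u + v).initialValue = u.initialValue + v.initialValue := by
      refine (u + v).initialValue_eq hT ?_
      have hf : (u + v).fn = u.fn + v.fn := rfl
      rw [hd, hf]
      filter_upwards [u.fn_ae_eq, v.fn_ae_eq, Lp.coeFn_add u.fn v.fn, ae_mem_Ioo]
        with s h1 h2 h3 hs
      rw [h3, Pi.add_apply, h1, h2, primitive_add _ _ (Ioo_subset_Icc_self hs)]
      abel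
    rw [h0, hd, primitive_add _ _ ht]
    abel
  · have hd : (c • u).deriv = c • u.deriv := rfl
    have h0 : (c • u).initialValue = c • u.initialValue := by
      refine (c • u).initialValue_eq hT ?_
      have hf : (c • u).fn = c • u.fn := rfl
      rw [hd, hf]
      filter_upwards [u.fn_ae_eq, Lp.coeFn_smul c u.fn, ae_mem_Ioo] with s h1 h3 hs
      rw [h3, Pi.smul_apply, h1, primitive_smul _ _ (Ioo_subset_Icc_self hs), smul_add]
    rw [h0, hd, primitive_smul _ _ ht, RingHom.id_apply, smul_add]

/-- Weakly convergent sequences are bounded (Banach-Steinhaus). -/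
theorem WeaklyConverges.exists_norm_le {X : Type*} [NormedAddCommGroup X] [NormedSpace ℝ X]
    {u : ℕ → X} {u₀ : X} (h : WeaklyConverges u u₀) : ∃ M, ∀ n, ‖u n‖ ≤ M := by
  obtain ⟨M, hM⟩ := banach_steinhaus (g := fun n => NormedSpace.inclusionInDoubleDual ℝ X (u n))
    fun ℓ => by
      obtain ⟨C, hC⟩ := (h ℓ).norm.bddAbove_range
      exact ⟨C, fun n => hC ⟨n, rfl⟩⟩
  refine ⟨M, fun n => ?_⟩
  have := (NormedSpace.inclusionInDoubleDualLi ℝ (E := X)).norm_map (u n)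
  exact this.symm.trans_le (hM n)

theorem WeaklyConverges.map {X Y : Type*} [NormedAddCommGroup X] [NormedSpace ℝ X]
    [NormedAddCommGroup Y] [NormedSpace ℝ Y] {u : ℕ → X} {u₀ : X} (h : WeaklyConverges u u₀)
    (L : X →L[ℝ] Y) : WeaklyConverges (fun n => L (u n)) (L u₀) :=
  fun ℓ => h (ℓ.comp L)

end BochnerH1

/-! ### Weak convergence in `H¹(I; H)` -/

section WeakConvergence

variable {T : ℝ} {H : Type*} [NormedAddCommGroup H] [InnerProductSpace ℝ H] [CompleteSpace H]

/-- For bounded sequences in `L²(I; H)`, convergence of the primitives implies weak convergence,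
since taking primitives is injective. -/
theorem weaklyConverges_of_tendsto_primitive {v : ℕ → BochnerL2 T H} {v₀ : BochnerL2 T H} {C : ℝ}
    (hC : ∀ n, ‖v n‖ ≤ C) (h : ∀ t ∈ Icc (0 : ℝ) T,
      Tendsto (fun n => primitive (v n) t) atTop (𝓝 (primitive v₀ t))) :
    WeaklyConverges v v₀ := by
  intro ℓ
  rw [tendsto_iff_ultrafilter]
  intro 𝒰 h𝒰
  obtain ⟨u, -, hu⟩ := exists_weak_limit 𝒰 hC
  have huv : u = v₀ := by
    rw [← sub_eq_zero]
    refine eq_zero_of_primitive_eq_zero _ fun t ht => ?_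
    rw [primitive_sub _ _ ht, sub_eq_zero]
    obtain ⟨L, hL⟩ := exists_primitive_clm H ht
    refine ext_inner_left ℝ fun a => ?_
    have h1 := hu ((innerSL ℝ a).comp L)
    simp only [ContinuousLinearMap.comp_apply, hL, innerSL_apply_apply] at h1
    exact tendsto_nhds_unique h1 (tendsto_const_nhds.inner ((h t ht).mono_left h𝒰))
  exact huv ▸ hu ℓ

/-- For sequences in `H¹(I; H)` with bounded derivatives, uniform convergence implies weak
convergence. -/
theorem BochnerH1.weaklyConverges_of_tendsto (hT : 0 < T) {z : ℕ → BochnerH1 T H}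
    {z₀ : BochnerH1 T H} {C : ℝ} (hC : ∀ n, ‖(z n).deriv‖ ≤ C)
    (h : Tendsto (fun n => (z n).toContinuousMap) atTop (𝓝 z₀.toContinuousMap)) :
    WeaklyConverges z z₀ := by
  have hpt : ∀ t ∈ Icc (0 : ℝ) T, Tendsto (fun n => (z n).initialValue + primitive (z n).deriv t)
      atTop (𝓝 (z₀.initialValue + primitive z₀.deriv t)) := fun t ht =>
    ((continuous_eval_const (F := C(Icc (0 : ℝ) T, H)) (⟨t, ht⟩ : Icc (0 : ℝ) T)).tendsto _).comp h
  have h0 : Tendsto (fun n => (z n).initialValue) atTop (𝓝 z₀.initialValue) := by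
    simpa using hpt 0 (left_mem_Icc.2 hT.le)
  have hd : WeaklyConverges (fun n => (z n).deriv) z₀.deriv := by
    refine weaklyConverges_of_tendsto_primitive hC fun t ht => ?_
    simpa using (hpt t ht).sub h0
  have hf : Tendsto (fun n => (z n).fn) atTop (𝓝 z₀.fn) := by
    rw [tendsto_iff_norm_sub_tendsto_zero] at h ⊢
    refine squeeze_zero (fun _ => norm_nonneg _) (fun n => ?_) (by simpa using h.const_mul √T)
    refine le_of_sq_le_sq ?_ (by positivity)
    rw [sq_norm_eq_integral, mul_pow, Real.sq_sqrt hT.le]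
    calc ∫ t in Ioo (0 : ℝ) T, ‖((z n).fn - z₀.fn : BochnerL2 T H) t‖ ^ 2
        ≤ ∫ _t in Ioo (0 : ℝ) T, ‖(z n).toContinuousMap - z₀.toContinuousMap‖ ^ 2 := by
          refine integral_mono_ae (integrable_norm_sq _) (integrable_const _) ?_
          filter_upwards [(z n).fn_ae_eq, z₀.fn_ae_eq, Lp.coeFn_sub (z n).fn z₀.fn, ae_mem_Ioo]
            with t h1 h2 h3 ht
          rw [h3, Pi.sub_apply, h1, h2]
          gcongr
          exact ((z n).toContinuousMap - z₀.toContinuousMap).norm_coe_le_norm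
            ⟨t, Ioo_subset_Icc_self ht⟩
      _ = _ := by
          rw [setIntegral_const, Measure.real, Real.volume_Ioo, sub_zero,
            ENNReal.toReal_ofReal hT.le, smul_eq_mul]
  intro ℓ
  obtain ⟨L, hL, -⟩ := exists_extension_norm_eq (BochnerH1Submodule T H) ℓ
  -- The extension splits into a functional of the function and one of its derivative.
  let J := (WithLp.prodContinuousLinearEquiv 2 ℝ (BochnerL2 T H) (BochnerL2 T H)).symm
  have hsplit : ∀ u : BochnerH1 T H, ℓ u = L (J (u.fn, 0)) + L (J (0, u.deriv)) := by
    intro u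
    rw [← hL, ← map_add, ← map_add, Prod.mk_add_mk, add_zero, zero_add]
    rfl
  simp only [hsplit]
  refine Tendsto.add ?_ ?_
  · have hc : Continuous fun f : BochnerL2 T H => L (J (f, 0)) := by fun_prop
    exact (hc.tendsto _).comp hf
  · exact hd ((L.comp J.toContinuousLinearMap).comp
      (ContinuousLinearMap.inr ℝ (BochnerL2 T H) (BochnerL2 T H)))

end WeakConvergence

/-! ### The control-to-state map -/

theorem norm_sub_le_of_equiv {H G : Type*} [NormedAddCommGroup H] [NormedSpace ℝ H]
    [NormedAddCommGroup G] [NormedSpace ℝ G] (e : H ≃L[ℝ] G) (x y : H) :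
    ‖x - y‖ ≤ ‖e.symm.toContinuousLinearMap‖ * ‖e x - e y‖ := by
  have h := e.symm.toContinuousLinearMap.le_opNorm (e (x - y))
  rw [map_sub e] at h
  have h2 : e.symm.toContinuousLinearMap (e x - e y) = x - y := by
    rw [← map_sub]; exact e.symm_apply_apply _
  rwa [h2] at h

section Transfer

variable {d : ℕ} {Ω : Opens (Space d)} {T : ℝ} {G : Type*} [NormedAddCommGroup G]
  [InnerProductSpace ℝ G] [CompleteSpace G]

/-- The load `f ∈ L²(Ω)` as an element of the Hilbert space `G ≅ H₀¹(Ω)`, by the Riesz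
representation; it is `(-Δ)⁻¹ f` when `e` turns the Dirichlet form into the inner product of `G`. -/
noncomputable def loadMap (e : H01 Ω ≃L[ℝ] G) : L2 Ω →L[ℝ] G :=
  (H01.val.comp e.symm.toContinuousLinearMap).adjoint

theorem inner_loadMap (e : H01 Ω ≃L[ℝ] G) (f : L2 Ω) (w : G) :
    ⟪loadMap e f, w⟫ = ⟪f, H01.val (e.symm w)⟫ :=
  ContinuousLinearMap.adjoint_inner_left _ _ _

theorem norm_loadMap_le (e : H01 Ω ≃L[ℝ] G) (f : L2 Ω) :
    ‖loadMap e f‖ ≤ ‖L2.toHneg1 f‖ * ‖e.symm.toContinuousLinearMap‖ := by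
  have h1 : ‖loadMap e f‖ ^ 2 ≤
      (‖L2.toHneg1 f‖ * ‖e.symm.toContinuousLinearMap‖) * ‖loadMap e f‖ := by
    rw [← real_inner_self_eq_norm_sq, inner_loadMap, mul_assoc]
    calc ⟪f, H01.val (e.symm (loadMap e f))⟫ ≤ ‖L2.toHneg1 f (e.symm (loadMap e f))‖ :=
          Real.le_norm_self _
      _ ≤ ‖L2.toHneg1 f‖ * ‖e.symm (loadMap e f)‖ := ContinuousLinearMap.le_opNorm _ _
      _ ≤ _ := by gcongr; exact e.symm.toContinuousLinearMap.le_opNorm _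
  rcases (norm_nonneg (loadMap e f)).eq_or_lt with h | h
  · rw [← h]; positivity
  · exact le_of_mul_le_mul_right (by rwa [← sq]) h

/-- The load `ℓ(t)` of the abstract evolution, as initial value plus primitive. -/
noncomputable def loadPath (e : H01 Ω ≃L[ℝ] G) (g : BochnerH1 T (L2 Ω)) (t : ℝ) : G :=
  loadMap e g.initialValue + primitive ((loadMap e).compLp g.deriv) t

theorem loadPath_eq (e : H01 Ω ≃L[ℝ] G) (g : BochnerH1 T (L2 Ω)) {t : ℝ}
    (ht : t ∈ Icc (0 : ℝ) T) :
    loadPath e g t = loadMap e (g.initialValue + primitive g.deriv t) := by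
  rw [loadPath, primitive_compLp _ _ ht, map_add]

theorem memLp_loadPath (e : H01 Ω ≃L[ℝ] G) (g : BochnerH1 T (L2 Ω)) :
    MemLp (loadPath e g) 2 (volume.restrict (Ioo (0 : ℝ) T)) :=
  memLp_const_add_primitive _ _

/-- The inclusion `0 ∈ ∂D(v) - Δz - f` in `H⁻¹(Ω)`, read in `G`. -/
theorem exists_mem_subdiff_iff (e : H01 Ω ≃L[ℝ] G)
    (he : ∀ z w, ⟪e z, e w⟫ = ⟪H01.grad z, H01.grad w⟫) {D : Seminorm ℝ G}
    (hD : ∀ w, D (e w) = dissipation w) (v z : H01 Ω) (f : L2 Ω) :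
    (∃ ξ ∈ subdiffDissipation v, 0 = ξ - laplacian z - L2.toHneg1 f) ↔
      IsSubgradient D (e v) (loadMap e f - e z) := by
  have hval : ∀ w, (laplacian z + L2.toHneg1 f) w = ⟪loadMap e f - e z, e w⟫ := by
    intro w
    rw [inner_sub_left, inner_loadMap, he, e.symm_apply_apply]
    change -⟪H01.grad z, H01.grad w⟫ + ⟪f, H01.val w⟫ = _
    ring
  have hmem : laplacian z + L2.toHneg1 f ∈ subdiffDissipation v ↔
      IsSubgradient D (e v) (loadMap e f - e z) := by
    constructor
    · intro h w
      have h1 := h (e.symm w)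
      rwa [hval, ← hD, ← hD, map_sub, e.apply_symm_apply] at h1
    · intro h w
      have h1 := h (e w)
      rwa [← map_sub, ← hval, hD, hD] at h1
  rw [← hmem]
  constructor
  · rintro ⟨ξ, hξ, h⟩
    rw [sub_sub, eq_comm, sub_eq_zero] at h
    exact h ▸ hξ
  · exact fun h => ⟨_, h, by abel⟩

/-- States are the solutions of the abstract evolution, transported by `e`. -/
theorem isState_iff (e : H01 Ω ≃L[ℝ] G)
    (he : ∀ z w, ⟪e z, e w⟫ = ⟪H01.grad z, H01.grad w⟫) {D : Seminorm ℝ G}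
    (hD : ∀ w, D (e w) = dissipation w) (g : BochnerH1 T (L2 Ω)) {z : BochnerH1 T (H01 Ω)}
    (hz : z.initialValue = 0) :
    IsState g z ↔
      IsApproxSolution D (loadPath e g) 0 (e.toContinuousLinearMap.compLp z.deriv) := by
  rw [isApproxSolution_zero, IsState, and_iff_right hz]
  refine eventually_congr ?_
  filter_upwards [z.fn_ae_eq, g.fn_ae_eq, e.toContinuousLinearMap.coeFn_compLp z.deriv, ae_mem_Ioo]
    with t h1 h2 h3 ht
  have ht' := Ioo_subset_Icc_self ht
  rw [exists_mem_subdiff_iff e he hD, h3, primitive_compLp _ _ ht', loadPath_eq e g ht', h1, h2, hz,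
    zero_add]
  rfl

theorem IsState.unique (e : H01 Ω ≃L[ℝ] G)
    (he : ∀ z w, ⟪e z, e w⟫ = ⟪H01.grad z, H01.grad w⟫) {D : Seminorm ℝ G}
    (hD : ∀ w, D (e w) = dissipation w) {g : BochnerH1 T (L2 Ω)} {z₁ z₂ : BochnerH1 T (H01 Ω)}
    (h₁ : IsState g z₁) (h₂ : IsState g z₂) : z₁ = z₂ := by
  refine BochnerH1.ext_of_initialValue_deriv (h₁.1.trans h₂.1.symm) ?_
  have h := ((isState_iff e he hD g h₁.1).1 h₁).unique ((isState_iff e he hD g h₂.1).1 h₂)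
  refine Lp.ext ?_
  filter_upwards [e.toContinuousLinearMap.coeFn_compLp z₁.deriv,
    e.toContinuousLinearMap.coeFn_compLp z₂.deriv] with t h3 h4
  rw [h] at h3
  exact e.injective (h3.symm.trans h4)

/-- A compatible initial load satisfies the stability condition `g(0) ∈ ∂D(0)`. -/
theorem Compatible.inner_loadMap_le [IsFiniteMeasure (domMeasure Ω)] (e : H01 Ω ≃L[ℝ] G)
    {D : Seminorm ℝ G} (hD : ∀ w, D (e w) = dissipation w) {g : BochnerH1 T (L2 Ω)}
    (hg : Compatible g) (w : G) : ⟪loadMap e g.initialValue, w⟫ ≤ D w := by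
  have h1 := eLpNorm_top_le_one_iff.1 hg
  rw [inner_loadMap, ← e.apply_symm_apply w, hD, e.symm_apply_apply, L2.inner_def]
  refine integral_mono_ae (L2.integrable_inner _ _) (integrable_L2 _).abs ?_
  filter_upwards [h1] with x hx
  calc ⟪g.initialValue x, H01.val (e.symm w) x⟫
      ≤ |g.initialValue x| * |H01.val (e.symm w) x| := real_inner_le_norm _ _
    _ ≤ 1 * |H01.val (e.symm w) x| := by gcongr
    _ = _ := one_mul _

/-- Existence of states, with a bound for the velocity. -/
theorem Compatible.exists_isState [IsFiniteMeasure (domMeasure Ω)] (hT : 0 < T) (e : H01 Ω ≃L[ℝ] G)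
    (he : ∀ z w, ⟪e z, e w⟫ = ⟪H01.grad z, H01.grad w⟫) {D : Seminorm ℝ G} (hDc : Continuous D)
    (hD : ∀ w, D (e w) = dissipation w) {g : BochnerH1 T (L2 Ω)} (hg : Compatible g) :
    ∃ z : BochnerH1 T (H01 Ω), IsState g z ∧
      ‖z.deriv‖ ≤ ‖e.symm.toContinuousLinearMap‖ * (‖loadMap e‖ * ‖g‖) := by
  obtain ⟨v, hvn, hv⟩ := exists_isApproxSolution_zero hDc hT (hg.inner_loadMap_le e hD)
    ((loadMap e).compLp g.deriv)
  obtain ⟨z, hz0, hzd⟩ := BochnerH1.exists_of_deriv hT 0 (e.symm.toContinuousLinearMap.compLp v)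
  have hev : e.toContinuousLinearMap.compLp z.deriv = v := by
    refine Lp.ext ?_
    rw [hzd]
    filter_upwards [e.toContinuousLinearMap.coeFn_compLp (e.symm.toContinuousLinearMap.compLp v),
      e.symm.toContinuousLinearMap.coeFn_compLp v] with t h1 h2
    rw [h1, h2]
    exact e.apply_symm_apply _
  refine ⟨z, (isState_iff e he hD g hz0).2 (hev.symm ▸ hv), ?_⟩
  rw [hzd]
  refine (ContinuousLinearMap.norm_compLp_le _ _).trans ?_
  gcongr
  refine (hvn.trans (ContinuousLinearMap.norm_compLp_le _ _)).trans ?_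
  gcongr
  exact g.norm_deriv_le

/-- The distance of two states in `C([0, T]; H₀¹(Ω))`, in terms of the distance of the loads in
`L²(I; G)` and of bounds for the velocities. -/
theorem IsState.norm_toContinuousMap_sub_le (e : H01 Ω ≃L[ℝ] G)
    (he : ∀ z w, ⟪e z, e w⟫ = ⟪H01.grad z, H01.grad w⟫) {D : Seminorm ℝ G}
    (hD : ∀ w, D (e w) = dissipation w) {g₁ g₂ : BochnerH1 T (L2 Ω)}
    {z₁ z₂ : BochnerH1 T (H01 Ω)} (h₁ : IsState g₁ z₁) (h₂ : IsState g₂ z₂) :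
    ‖z₁.toContinuousMap - z₂.toContinuousMap‖ ≤ ‖e.symm.toContinuousLinearMap‖ *
      √(2 * (√(∫ t in Ioo (0 : ℝ) T, ‖loadPath e g₁ t - loadPath e g₂ t‖ ^ 2) *
        (‖e.toContinuousLinearMap‖ * (‖z₁.deriv‖ + ‖z₂.deriv‖)))) := by
  refine (ContinuousMap.norm_le _ (by positivity)).2 fun t => ?_
  have hsub : (z₁.toContinuousMap - z₂.toContinuousMap) t
      = primitive z₁.deriv t - primitive z₂.deriv t := by
    rw [ContinuousMap.sub_apply, BochnerH1.toContinuousMap_apply,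
      BochnerH1.toContinuousMap_apply, h₁.1, h₂.1, zero_add, zero_add]
  have h := ((isState_iff e he hD g₁ h₁.1).1 h₁).sq_norm_sub_le
    ((isState_iff e he hD g₂ h₂.1).1 h₂)
    ((memLp_loadPath e g₁).sub (memLp_loadPath e g₂)).norm (fun s _ => by simp) t.2
  have hv : ‖e.toContinuousLinearMap.compLp z₁.deriv - e.toContinuousLinearMap.compLp z₂.deriv‖ ≤
      ‖e.toContinuousLinearMap‖ * (‖z₁.deriv‖ + ‖z₂.deriv‖) := by
    rw [mul_add]
    exact (norm_sub_le _ _).trans (add_le_add (ContinuousLinearMap.norm_compLp_le _ _)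
      (ContinuousLinearMap.norm_compLp_le _ _))
  have hp : ∀ z : BochnerL2 T (H01 Ω),
      primitive (e.toContinuousLinearMap.compLp z) t = e (primitive z t) := fun z =>
    primitive_compLp e.toContinuousLinearMap z t.2
  rw [hp, hp] at h
  rw [hsub]
  refine (norm_sub_le_of_equiv e _ _).trans ?_
  refine mul_le_mul_of_nonneg_left (Real.le_sqrt_of_sq_le (h.trans ?_)) (by positivity)
  exact mul_le_mul_of_nonneg_left (mul_le_mul_of_nonneg_left hv (Real.sqrt_nonneg _)) zero_le_two

theorem controlToState_eq {g : BochnerH1 T (L2 Ω)} {z : BochnerH1 T (H01 Ω)}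
    (hz : IsState g z) (huniq : ∀ z', IsState g z' → z' = z) : controlToState g = z := by
  have h : ∃ z, IsState g z := ⟨z, hz⟩
  rw [controlToState, dif_pos h]
  exact huniq _ h.choose_spec

/-- The loads converge in `L²(I; G)`: pointwise in time by compactness, then by dominated
convergence. -/
theorem tendsto_integral_sq_loadPath (hΩ : Bornology.IsBounded (Ω : Set (Space d))) (hT : 0 < T)
    (e : H01 Ω ≃L[ℝ] G) {g : ℕ → BochnerH1 T (L2 Ω)} {g₀ : BochnerH1 T (L2 Ω)}
    (hg : WeaklyConverges g g₀) :
    Tendsto (fun n => ∫ t in Ioo (0 : ℝ) T, ‖loadPath e (g n) t - loadPath e g₀ t‖ ^ 2) atTop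
      (𝓝 0) := by
  obtain ⟨M, hM⟩ := hg.exists_norm_le
  obtain ⟨C, hC⟩ := BochnerH1.exists_evaluation hT (L2 Ω)
  have hC0 : ∀ t ∈ Icc (0 : ℝ) T, ∀ n, ‖((g n).initialValue + primitive (g n).deriv t) -
      (g₀.initialValue + primitive g₀.deriv t)‖ ≤ |C| * (M + ‖g₀‖) := by
    intro t ht n
    obtain ⟨L, hL, hLb⟩ := hC t ht
    rw [← hL, ← hL, ← map_sub]
    refine (hLb _).trans (mul_le_mul (le_abs_self C) ?_ (norm_nonneg _) (abs_nonneg _))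
    exact (norm_sub_le _ _).trans (by gcongr; exact hM n)
  have hdiff : ∀ t ∈ Icc (0 : ℝ) T, ∀ n, loadPath e (g n) t - loadPath e g₀ t =
      loadMap e (((g n).initialValue + primitive (g n).deriv t) -
        (g₀.initialValue + primitive g₀.deriv t)) := by
    intro t ht n
    rw [loadPath_eq e _ ht, loadPath_eq e _ ht, map_sub]
  have h0 : Tendsto (fun n => ∫ t in Ioo (0 : ℝ) T, ‖loadPath e (g n) t - loadPath e g₀ t‖ ^ 2)
      atTop (𝓝 (∫ _t in Ioo (0 : ℝ) T, (0 : ℝ) ^ 2)) := by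
    refine tendsto_integral_of_dominated_convergence
      (fun _ => (‖loadMap e‖ * (|C| * (M + ‖g₀‖))) ^ 2) (fun n => ?_) (integrable_const _)
      (fun n => ?_) ?_
    · exact ((memLp_loadPath e (g n)).sub (memLp_loadPath e g₀)).1.norm.pow 2
    · filter_upwards [ae_mem_Ioo] with t ht
      have ht' := Ioo_subset_Icc_self ht
      rw [Real.norm_of_nonneg (by positivity), hdiff t ht' n]
      gcongr
      exact ((loadMap e).le_opNorm _).trans (by gcongr; exact hC0 t ht' n)
    · filter_upwards [ae_mem_Ioo] with t ht
      have ht' := Ioo_subset_Icc_self ht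
      obtain ⟨L, hL, hLb⟩ := hC t ht'
      have hw : WeaklyConverges (fun n => ((g n).initialValue + primitive (g n).deriv t) -
          (g₀.initialValue + primitive g₀.deriv t)) 0 := by
        intro ℓ
        have h1 := (hg.map L ℓ).sub_const (ℓ (L g₀))
        simp only [hL, ← map_sub, sub_self] at h1
        rw [map_zero]
        exact h1
      have h2 := (tendsto_norm_toHneg1 hΩ (hC0 t ht') hw).mul_const
        ‖e.symm.toContinuousLinearMap‖
      rw [zero_mul] at h2
      have h3 := squeeze_zero (fun _ => norm_nonneg _) (fun n => norm_loadMap_le e _) h2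
      simp only [hdiff t ht']
      exact h3.pow 2
  simpa using h0

theorem Compatible.isState_controlToState [IsFiniteMeasure (domMeasure Ω)] (hT : 0 < T)
    (e : H01 Ω ≃L[ℝ] G) (he : ∀ z w, ⟪e z, e w⟫ = ⟪H01.grad z, H01.grad w⟫) {D : Seminorm ℝ G}
    (hDc : Continuous D) (hD : ∀ w, D (e w) = dissipation w) {g : BochnerH1 T (L2 Ω)}
    (hg : Compatible g) : IsState g (controlToState g) ∧
      ‖(controlToState g).deriv‖ ≤ ‖e.symm.toContinuousLinearMap‖ * (‖loadMap e‖ * ‖g‖) := by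
  obtain ⟨z, hz, hzn⟩ := hg.exists_isState hT e he hDc hD
  rw [controlToState_eq hz fun z' hz' => hz'.unique e he hD hz]
  exact ⟨hz, hzn⟩

/-- Weakly convergent compatible loads have uniformly convergent states with bounded velocities. -/
theorem tendsto_controlToState (hΩ : Bornology.IsBounded (Ω : Set (Space d))) (hT : 0 < T)
    (e : H01 Ω ≃L[ℝ] G) (he : ∀ z w, ⟪e z, e w⟫ = ⟪H01.grad z, H01.grad w⟫) {D : Seminorm ℝ G}
    (hDc : Continuous D) (hD : ∀ w, D (e w) = dissipation w) {g : ℕ → BochnerH1 T (L2 Ω)}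
    {g₀ : BochnerH1 T (L2 Ω)} (hcompat : ∀ n, Compatible (g n)) (hcompat₀ : Compatible g₀)
    (hg : WeaklyConverges g g₀) :
    (∃ C, ∀ n, ‖(controlToState (g n)).deriv‖ ≤ C) ∧
    Tendsto (fun n => (controlToState (g n)).toContinuousMap) atTop
      (𝓝 (controlToState g₀).toContinuousMap) := by
  have := isFiniteMeasure_domMeasure hΩ
  obtain ⟨M, hM⟩ := hg.exists_norm_le
  set C := ‖e.symm.toContinuousLinearMap‖ * (‖loadMap e‖ * M) with hCdef
  have hstate := fun n => (hcompat n).isState_controlToState hT e he hDc hD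
  have hC : ∀ n, ‖(controlToState (g n)).deriv‖ ≤ C := fun n =>
    (hstate n).2.trans (by rw [hCdef]; gcongr; exact hM n)
  refine ⟨⟨C, hC⟩, ?_⟩
  set K := ‖e.toContinuousLinearMap‖ * (C + ‖(controlToState g₀).deriv‖) with hK
  rw [tendsto_iff_norm_sub_tendsto_zero]
  have h1 := (((tendsto_integral_sq_loadPath hΩ hT e hg).sqrt.mul_const K).const_mul
    2).sqrt.const_mul ‖e.symm.toContinuousLinearMap‖
  simp only [Real.sqrt_zero, zero_mul, mul_zero] at h1
  refine squeeze_zero (fun _ => norm_nonneg _) (fun n => ?_) h1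
  refine ((hstate n).1.norm_toContinuousMap_sub_le e he hD
    (hcompat₀.isState_controlToState hT e he hDc hD).1).trans ?_
  rw [hK]
  gcongr
  exact hC n

end Transfer

end RateIndependent

open RateIndependent in
theorem mainTheorem3 {d : ℕ} (hd : 1 ≤ d) (Ω : Opens (Space d))
    (hΩ : Bornology.IsBounded (Ω : Set (Space d))) {T : ℝ} (hT : 0 < T)
    (g : ℕ → BochnerH1 T (L2 Ω)) (g₀ : BochnerH1 T (L2 Ω))
    (hcompat : ∀ n, Compatible (g n)) (hg : WeaklyConverges g g₀) :
    -- all states are well defined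
    Compatible g₀ ∧
    (∀ n, ∃! z : BochnerH1 T (H01 Ω), IsState (g n) z) ∧
    (∃! z : BochnerH1 T (H01 Ω), IsState g₀ z) ∧
    -- weak convergence in `H¹(I; H₀¹(Ω))`
    WeaklyConverges (fun n => controlToState (g n)) (controlToState g₀) ∧
    -- strong convergence in `C([0, T]; H₀¹(Ω))`
    Tendsto (fun n => (controlToState (g n)).toContinuousMap) atTop
      (𝓝 (controlToState g₀).toContinuousMap) := by
  have := isFiniteMeasure_domMeasure hΩ
  obtain ⟨G, _, e, he⟩ := H01.exists_equiv hd hΩ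
  obtain ⟨D₀, hD₀c, hD₀⟩ := exists_dissipation_seminorm (Ω := Ω)
  let D : Seminorm ℝ G := D₀.comp (e.symm : G →ₗ[ℝ] H01 Ω)
  have hDc : Continuous D := hD₀c.comp e.symm.continuous
  have hD : ∀ w, D (e w) = dissipation w := by
    intro w
    change D₀ (e.symm (e w)) = _
    rw [e.symm_apply_apply, hD₀]
  have hcompat₀ : Compatible g₀ := by
    refine eLpNorm_top_le_one_iff.2 ?_
    obtain ⟨C, hC⟩ := BochnerH1.exists_evaluation hT (L2 Ω)
    obtain ⟨L, hL, -⟩ := hC 0 (left_mem_Icc.2 hT.le)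
    simp only [primitive_zero_right, add_zero] at hL
    have h1 := hg.map L
    simp only [hL] at h1
    exact ae_abs_le_one_of_weaklyConverges h1 fun n => eLpNorm_top_le_one_iff.1 (hcompat n)
  have hunique : ∀ g : BochnerH1 T (L2 Ω), Compatible g →
      ∃! z : BochnerH1 T (H01 Ω), IsState g z := by
    intro g hg
    obtain ⟨z, hz, -⟩ := hg.exists_isState hT e he hDc hD
    exact ⟨z, hz, fun z' hz' => hz'.unique e he hD hz⟩
  obtain ⟨⟨C, hC⟩, hstrong⟩ := tendsto_controlToState hΩ hT e he hDc hD hcompat hcompat₀ hg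
  exact ⟨hcompat₀, fun n => hunique _ (hcompat n), hunique _ hcompat₀,
    BochnerH1.weaklyConverges_of_tendsto hT hC hstrong, hstrong⟩
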